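/- Let $M$ be a unital (complex) $C^*$-algebra. A \emph{normed ideal} of $M$ with a unitarily invariant norm is obtained as follows: $\mathcal I_0\subset M$ is a two-sided ideal with a norm $\|\cdot\|_{\mathcal I}$ such that $\|XTZ\|_{\mathcal I}\le\|X\|\,\|T\|_{\mathcal I}\,\|Z\|$ for all $X,Z\in M$, $T\in\mathcal I_0$, and $\mathcal I$ is the completion of $(\mathcal I_0,\|\cdot\|_{\mathcal I})$. The ideal is called complex or real according to whether $(\mathcal I_0,\|\cdot\|_{\mathcal I})$ is considered as a complex or as a real normed space; $\mathcal B(\mathcal I)$ is the algebra of bounded complex-linear, respectively real-linear, operators on $\mathcal I$. The maps $L_X(T)=XT$ and $R_Y(T)=TY$ extend to bounded operators on $\mathcal I$, denoted in the same way, and we write $XTY$ for $L_XR_YT$ also when $T\in\mathcal I$. Let $F:\mathbb C\to\mathbb C$ be an entire function of order $\limsup_{r\to\infty}\frac{\ln\ln\max_{|z|\le r}|F(z)|}{\ln r}\le 1$ (constants having order $0$) all of whose nonzero roots are purely imaginary, so that in particular $F\not\equiv0$. Then $F$ has a Weierstrass factorization $$F(z)=\lambda\,e^{\alpha z}z^n\prod_k\Big(1-\frac{iz}{z_k}\Big)e^{iz/z_k},\qquad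 (*)$$ with $n\ge 0$ an integer, $\alpha\in\mathbb C$, a finite or countable family $z_k\in\mathbb R\setminus\{0\}$, $\lambda=F(z)/z^n|_{z=0}\neq0$, and the product converging uniformly on compact sets. For any such factorization put $b=\operatorname{Re}\alpha$. For $X,Y\in M$ self-adjoint put $F_{X,Y}=F(L_X+R_Y)=\sum_{k\ge0}\frac{F^{(k)}(0)}{k!}(L_X+R_Y)^k\in\mathcal B(\mathcal I)$. If $\mathcal I$ is a complex normed ideal of $M$ with a unitarily invariant norm, then: \begin{enumerate} \item For all $T\in\mathcal I$, $$\|F_{X,Y}T\|_{\mathcal I}\ \ge\ |\lambda|\,\Big\|\sum_{k=0}^n\binom nk X^ke^{bX}\,T\,e^{bY}Y^{n-k}\Big\|_{\mathcal I}.$$ \item If $F(0)\ne0$, then $F_{X,Y}$ is invertible in $\mathcal B(\mathcal I)$ and $$\|F_{X,Y}^{-1}\|_{\mathcal B(\mathcal I)}\le|\lambda|^{-1}\,\|e^{-bX}\|\,\|e^{-bY}\|.$$ \item If $|F(0)|=1$ and $\alpha$ is purely imaginary, then $\|F_{X,Y}T\|_{\mathcal I}\ge\|T\|_{\mathcal I}$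 for all $T\in\mathcal I$, and $F_{X,Y}$ is invertible in $\mathcal B(\mathcal I)$ with inverse a contraction. \item If $\mathcal I$ is a real normed ideal of $M$ with a unitarily invariant norm, assertions 1--3 hold provided that moreover $F(\mathbb R)\subset\mathbb R$. \end{enumerate} -/

import Mathlib

open Filter Topology

noncomputable section

/-- The maximum modulus `M(r) = max_{|w| ≤ r} |F(w)|`. -/
def maxModulus (F : ℂ → ℂ) (r : ℝ) : ℝ :=
  sSup ((fun w => ‖F w‖) '' Metric.closedBall (0 : ℂ) r)

/-- The order of growth `limsup_{r → ∞} log log M(r) / log r`, as an extended real. -/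
def growthOrder (F : ℂ → ℂ) : EReal :=
  limsup (fun r : ℝ =>
    ((Real.log (Real.log (maxModulus F r)) / Real.log r : ℝ) : EReal)) atTop

/-- `F(w) = lam * e^{alpha w} * w^n * ∏ₖ (1 - i w / zₖ) e^{i w / zₖ}` with a finite or countably
infinite family of nonzero reals `zₖ`, the product converging uniformly on compact sets, where
`lam` is the nonzero value of `F(w) / w^n` at `w = 0`. -/
structure IsWeierstrassFactorization (F : ℂ → ℂ) (lam alpha : ℂ) (n : ℕ) {ι : Type}
    (z : ι → ℝ) : Prop where
  countable : Countable ι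
  root_ne_zero : ∀ k, z k ≠ 0
  lam_ne_zero : lam ≠ 0
  lam_eq : Tendsto (fun w => F w / w ^ n) (𝓝[≠] 0) (𝓝 lam)
  factorization : ∃ P : ℂ → ℂ,
    HasProdLocallyUniformly
      (fun k w => (1 - Complex.I * w / (z k : ℂ)) * Complex.exp (Complex.I * w / (z k : ℂ))) P ∧
    ∀ w, F w = lam * Complex.exp (alpha * w) * w ^ n * P w

/-- The `k`-th coefficient of the power series of `F` at `0`. -/
def taylorCoeff (F : ℂ → ℂ) (k : ℕ) : ℂ :=
  (k.factorial : ℂ)⁻¹ * iteratedDeriv k F 0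

/-- A two-sided ideal `I₀` of a unital C*-algebra `M`, with a norm of its own over `𝕜`
(`ℂ` or `ℝ`), such that `‖X T Z‖_I ≤ ‖X‖ ‖T‖_I ‖Z‖`. -/
structure NormedIdeal (𝕜 M : Type*) [RCLike 𝕜] [CStarAlgebra M] [Algebra 𝕜 M] where
  carrier : Submodule 𝕜 M
  mul_mem_left : ∀ (X : M) {T : M}, T ∈ carrier → X * T ∈ carrier
  mul_mem_right : ∀ {T : M} (Z : M), T ∈ carrier → T * Z ∈ carrier
  idealNorm : carrier → ℝ
  idealNorm_nonneg : ∀ T, 0 ≤ idealNorm T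
  idealNorm_eq_zero : ∀ T, idealNorm T = 0 ↔ T = 0
  idealNorm_smul : ∀ (c : 𝕜) (T), idealNorm (c • T) = ‖c‖ * idealNorm T
  idealNorm_add_le : ∀ S T, idealNorm (S + T) ≤ idealNorm S + idealNorm T
  idealNorm_mul_mul_le : ∀ (X : M) (T : carrier) (Z : M),
    idealNorm ⟨X * T * Z, mul_mem_right Z (mul_mem_left X T.2)⟩ ≤ ‖X‖ * idealNorm T * ‖Z‖

namespace NormedIdeal

variable {𝕜 M : Type*} [RCLike 𝕜] [CStarAlgebra M] [Algebra 𝕜 M] (I : NormedIdeal 𝕜 M)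

/-- The ideal `I₀` as a type, carrying the norm `‖·‖_I` and not the norm of `M`. -/
def Core : Type _ := I.carrier

instance : AddCommGroup I.Core := inferInstanceAs (AddCommGroup I.carrier)

instance : Module 𝕜 I.Core := inferInstanceAs (Module 𝕜 I.carrier)

instance : Norm I.Core := ⟨I.idealNorm⟩

theorem normedSpaceCore : NormedSpace.Core 𝕜 I.Core where
  norm_nonneg := I.idealNorm_nonneg
  norm_smul := I.idealNorm_smul
  norm_triangle := I.idealNorm_add_le
  norm_eq_zero_iff := I.idealNorm_eq_zero

instance : NormedAddCommGroup I.Core := NormedAddCommGroup.ofCore I.normedSpaceCore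

instance : NormedSpace 𝕜 I.Core := NormedSpace.ofCore I.normedSpaceCore

/-- The Banach space `I`: the completion of `I₀` for the norm `‖·‖_I`. -/
abbrev Space : Type _ := UniformSpace.Completion I.Core

/-- Left multiplication `T ↦ X T` on `I₀`. -/
def coreL (X : M) : I.Core →L[𝕜] I.Core :=
  LinearMap.mkContinuous
    { toFun := fun T => (⟨X * T.1, I.mul_mem_left X T.2⟩ : I.carrier)
      map_add' := fun S T => Subtype.ext (mul_add X S.1 T.1)
      map_smul' := fun c T => Subtype.ext (mul_smul_comm c X T.1) }
    (‖X‖ * ‖(1 : M)‖) (fun T => by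
      have h := I.idealNorm_mul_mul_le X T 1
      simp only [mul_one] at h
      rw [mul_right_comm] at h
      exact h)

/-- Right multiplication `T ↦ T Y` on `I₀`. -/
def coreR (Y : M) : I.Core →L[𝕜] I.Core :=
  LinearMap.mkContinuous
    { toFun := fun T => (⟨T.1 * Y, I.mul_mem_right Y T.2⟩ : I.carrier)
      map_add' := fun S T => Subtype.ext (add_mul S.1 T.1 Y)
      map_smul' := fun c T => Subtype.ext (smul_mul_assoc c T.1 Y) }
    (‖(1 : M)‖ * ‖Y‖) (fun T => by
      have h := I.idealNorm_mul_mul_le 1 T Y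
      simp only [one_mul] at h
      rw [mul_right_comm] at h
      exact h)

/-- The bounded extension of `L_X` to the completion. -/
def L (X : M) : I.Space →L[𝕜] I.Space :=
  ((UniformSpace.Completion.toComplL : I.Core →L[𝕜] I.Space).comp (I.coreL X)).extend
    (UniformSpace.Completion.toComplL : I.Core →L[𝕜] I.Space)

/-- The bounded extension of `R_Y` to the completion. -/
def R (Y : M) : I.Space →L[𝕜] I.Space :=
  ((UniformSpace.Completion.toComplL : I.Core →L[𝕜] I.Space).comp (I.coreR Y)).extend
    (UniformSpace.Completion.toComplL : I.Core →L[𝕜] I.Space)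

theorem L_coe (X : M) (T : I.Core) :
    I.L X (T : I.Space) = ((I.coreL X T : I.Core) : I.Space) :=
  ContinuousLinearMap.extend_eq _ UniformSpace.Completion.denseRange_coe
    (UniformSpace.Completion.isUniformInducing_coe _) T

theorem R_coe (Y : M) (T : I.Core) :
    I.R Y (T : I.Space) = ((I.coreR Y T : I.Core) : I.Space) :=
  ContinuousLinearMap.extend_eq _ UniformSpace.Completion.denseRange_coe
    (UniformSpace.Completion.isUniformInducing_coe _) T

end NormedIdeal

/-- `F(A) = ∑ₖ cₖ A^k` for an entire function `F(w) = ∑ₖ cₖ w^k` and a bounded operator `A` of a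
complex Banach space. -/
def entireCalculus {E : Type*} [NormedAddCommGroup E] [NormedSpace ℂ E] (F : ℂ → ℂ)
    (A : E →L[ℂ] E) : E →L[ℂ] E :=
  ∑' k, taylorCoeff F k • A ^ k

/-- `F(A) = ∑ₖ cₖ A^k` for an entire function `F(w) = ∑ₖ cₖ w^k` with `F(ℝ) ⊆ ℝ` (so that the
coefficients `cₖ` are real) and a bounded operator `A` of a real Banach space. -/
def realEntireCalculus {E : Type*} [NormedAddCommGroup E] [NormedSpace ℝ E] (F : ℂ → ℂ)
    (A : E →L[ℝ] E) : E →L[ℝ] E :=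
  ∑' k, (taylorCoeff F k).re • A ^ k

theorem summable_norm_taylorCoeff_mul_pow {F : ℂ → ℂ} (hF : Differentiable ℂ F) (r : ℝ) :
    Summable fun k => ‖taylorCoeff F k‖ * |r| ^ k := by
  have h := (Complex.hasSum_taylorSeries_of_entire hF 0 (r : ℂ)).summable.norm
  refine h.congr fun k => ?_
  simp only [taylorCoeff, sub_zero, smul_eq_mul, norm_mul, norm_pow, Complex.norm_real,
    Real.norm_eq_abs]
  ring

/-- The series of `entireCalculus` converges in operator norm. -/
theorem entireCalculus_hasSum {E : Type*} [NormedAddCommGroup E] [NormedSpace ℂ E]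
    [CompleteSpace E] {F : ℂ → ℂ} (hF : Differentiable ℂ F) (A : E →L[ℂ] E) :
    HasSum (fun k => taylorCoeff F k • A ^ k) (entireCalculus F A) := by
  refine Summable.hasSum (Summable.of_norm_bounded_eventually_nat
    (summable_norm_taylorCoeff_mul_pow hF ‖A‖) ?_)
  filter_upwards [eventually_gt_atTop 0] with k hk
  rw [norm_smul, abs_norm]
  exact mul_le_mul_of_nonneg_left (norm_pow_le' A hk) (norm_nonneg _)

/-- The series of `realEntireCalculus` converges in operator norm. -/
theorem realEntireCalculus_hasSum {E : Type*} [NormedAddCommGroup E] [NormedSpace ℝ E]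
    [CompleteSpace E] {F : ℂ → ℂ} (hF : Differentiable ℂ F) (A : E →L[ℝ] E) :
    HasSum (fun k => (taylorCoeff F k).re • A ^ k) (realEntireCalculus F A) := by
  refine Summable.hasSum (Summable.of_norm_bounded_eventually_nat
    (summable_norm_taylorCoeff_mul_pow hF ‖A‖) ?_)
  filter_upwards [eventually_gt_atTop 0] with k hk
  rw [norm_smul, abs_norm]
  exact mul_le_mul (Complex.abs_re_le_norm _) (norm_pow_le' A hk) (norm_nonneg _) (norm_nonneg _)

end

/-! Put `A = L_X + R_Y`. Left and right multiplications commute, so `exp(itA) = L_{exp(itX)}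
R_{exp(itY)}`, and for self-adjoint `X`, `Y` this is a contraction for every real `t`. Everything
about `F(A)` follows from this property of `A` and the factorization of `F`.

If `‖exp(tD)‖ ≤ 1` for all real `t`, then `1 - sD` is bounded below by 1 and is invertible with
contractive inverse for every real `s` (`HasContractiveInverse.one_sub_smul`). With `D = iA` and `s
= 1/z_k`, each Weierstrass factor evaluated at `A` is such an operator times an invertible operator
`exp(iA/z_k)` whose inverse is also a contraction. Contractive inverses survive products and norm
limits (`HasContractiveInverse.of_tendsto`), and the functional calculus is multiplicative and
continuous for locally uniform convergence, so the infinite product `P(A)` has a contractive inverse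
too. Since `exp(i Im(α) A)` and its inverse are contractions, only `λ exp(bA) A^n` remains;
expanding it by the binomial theorem gives the lower bound, and `n = 0` gives invertibility.

Existence of the factorization is Hadamard's theorem in genus one. Divide out the zeros in a disc of
radius `R`; the maximum principle on the circle of radius `3R` bounds both the number of these zeros
and the quotient. The logarithm of the quotient is then linear up to `O(R^(p-2))`, where `p < 2`,
and `R → ∞` gives the product.

A real ideal is invariant under multiplication by `i1`, so its completion carries a complex
structure for which the complex argument applies; `F(ℝ) ⊆ ℝ` makes the real and complex calculi
agree. -/

/-! ### Zeros of entire functions and finite factorizations -/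

theorem Differentiable.exists_eq_pow_analyticOrderNatAt_mul {f : ℂ → ℂ} (hf : Differentiable ℂ f)
    {a : ℂ} (ha : analyticOrderAt f a ≠ ⊤) :
    ∃ g : ℂ → ℂ, Differentiable ℂ g ∧ g a ≠ 0 ∧
      ∀ w, f w = (w - a) ^ analyticOrderNatAt f a * g w := by
  obtain ⟨g, hg, hga, hfg⟩ := (hf.analyticAt a).analyticOrderAt_ne_top.mp ha
  set m := analyticOrderNatAt f a
  -- The local quotient `g` supplies the missing value of the global quotient at its removable
  -- singularity.
  set G : ℂ → ℂ := Function.update (fun w => f w / (w - a) ^ m) a (g a) with hG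
  have hGg : G =ᶠ[𝓝 a] g := by
    filter_upwards [hfg] with w hw
    rcases eq_or_ne w a with rfl | hwa
    · simp [hG]
    · have : w - a ≠ 0 := sub_ne_zero.2 hwa
      simp [hG, Function.update_of_ne hwa, hw, this]
  refine ⟨G, fun w => ?_, by simpa [hG] using hga, fun w => ?_⟩
  · rcases eq_or_ne w a with rfl | hwa
    · exact (hg.differentiableAt.congr_of_eventuallyEq hGg)
    · have h1 : G =ᶠ[𝓝 w] fun w => f w / (w - a) ^ m := by
        filter_upwards [isOpen_ne.mem_nhds hwa] with v hv
        simp [hG, Function.update_of_ne hv]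
      refine DifferentiableAt.congr_of_eventuallyEq ?_ h1
      exact (hf w).div (by fun_prop) (pow_ne_zero _ (sub_ne_zero.2 hwa))
  · rcases eq_or_ne w a with rfl | hwa
    · simpa [hG] using hfg.self_of_nhds
    · have : w - a ≠ 0 := sub_ne_zero.2 hwa
      simp only [hG, Function.update_of_ne hwa]
      field_simp

theorem Differentiable.exists_eq_prod_pow_analyticOrderNatAt_mul {f : ℂ → ℂ}
    (hf : Differentiable ℂ f) (hord : ∀ a, analyticOrderAt f a ≠ ⊤) (Z : Finset ℂ) :
    ∃ g : ℂ → ℂ, Differentiable ℂ g ∧ (∀ a ∈ Z, g a ≠ 0) ∧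
      ∀ w, f w = (∏ a ∈ Z, (w - a) ^ analyticOrderNatAt f a) * g w := by
  induction Z using Finset.induction_on with
  | empty => exact ⟨f, hf, by simp, by simp⟩
  | insert b Z hb ih =>
    obtain ⟨g, hg, hgZ, hfg⟩ := ih
    set h : ℂ → ℂ := fun w => ∏ a ∈ Z, (w - a) ^ analyticOrderNatAt f a with hh
    have hhd : Differentiable ℂ h := by fun_prop
    have hhb : h b ≠ 0 := Finset.prod_ne_zero_iff.2 fun a ha =>
      pow_ne_zero _ (sub_ne_zero.2 fun hba => hb (hba ▸ ha))
    have hfe : f = h * g := funext hfg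
    -- The factors already removed do not vanish at `b`, so the quotient keeps the full order of `f`
    -- there.
    have hbe : analyticOrderAt f b = analyticOrderAt g b := by
      rw [hfe, analyticOrderAt_mul (hhd.analyticAt b) (hg.analyticAt b),
        analyticOrderAt_eq_zero.2 (Or.inr hhb), zero_add]
    obtain ⟨g', hg', hg'b, hgg'⟩ := hg.exists_eq_pow_analyticOrderNatAt_mul (hbe ▸ hord b)
    refine ⟨g', hg', ?_, fun w => ?_⟩
    · intro a ha
      rcases Finset.mem_insert.1 ha with rfl | ha
      · exact hg'b
      · intro h0
        exact hgZ a ha (by rw [hgg', h0, mul_zero])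
    · rw [hfg w, Finset.prod_insert hb, hgg' w, analyticOrderNatAt, analyticOrderNatAt, hbe]
      ring

theorem Differentiable.analyticOrderAt_ne_top {f : ℂ → ℂ} (hf : Differentiable ℂ f) {b : ℂ}
    (hb : f b ≠ 0) (a : ℂ) : analyticOrderAt f a ≠ ⊤ := by
  rw [Ne, analyticOrderAt_eq_top]
  intro h
  have han : AnalyticOnNhd ℂ f Set.univ := fun x _ => hf.analyticAt x
  exact hb (han.eqOn_zero_of_preconnected_of_eventuallyEq_zero isPreconnected_univ
    (Set.mem_univ a) h (Set.mem_univ b))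

theorem Differentiable.finite_zeros_closedBall {f : ℂ → ℂ} (hf : Differentiable ℂ f) {b : ℂ}
    (hb : f b ≠ 0) (R : ℝ) : {a | f a = 0 ∧ ‖a‖ ≤ R}.Finite := by
  have han : AnalyticOnNhd ℂ f Set.univ := fun x _ => hf.analyticAt x
  by_contra hinf
  have hinf : {a | f a = 0 ∧ ‖a‖ ≤ R}.Infinite := hinf
  obtain ⟨a, -, ha⟩ := hinf.exists_accPt_of_subset_isCompact
    (isCompact_closedBall (0 : ℂ) R) (fun x hx => by simpa using hx.2)
  refine hb (han.eqOn_zero_of_preconnected_of_frequently_eq_zero isPreconnected_univ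
    (Set.mem_univ a) ?_ (Set.mem_univ b))
  exact (accPt_iff_frequently_nhdsNE.1 ha).mono fun x hx => hx.1

/-- The nonzero zeros `a k` of an entire function, counted with multiplicity, with the
corresponding finite factorizations on discs. -/
structure IsZeroEnumeration (f : ℂ → ℂ) {ι : Type} (a : ι → ℂ) (S : ℝ → Finset ι) : Prop where
  ne_zero : ∀ k, a k ≠ 0
  isRoot : ∀ k, f (a k) = 0
  mem_iff : ∀ R k, k ∈ S R ↔ ‖a k‖ ≤ R
  exists_factor : ∀ R, ∃ K : ℂ → ℂ, Differentiable ℂ K ∧ (∀ w, ‖w‖ ≤ R → K w ≠ 0) ∧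
    ∀ w, f w = (∏ k ∈ S R, (1 - w / a k)) * K w

theorem Differentiable.exists_isZeroEnumeration {f : ℂ → ℂ} (hf : Differentiable ℂ f)
    (h0 : f 0 ≠ 0) :
    ∃ (ι : Type) (a : ι → ℂ) (S : ℝ → Finset ι), IsZeroEnumeration f a S := by
  have hord := hf.analyticOrderAt_ne_top h0
  have hroot : ∀ k : (Σ a : ℂ, Fin (analyticOrderNatAt f a)), f k.1 = 0 := by
    rintro ⟨a, j⟩
    by_contra hne
    have : analyticOrderNatAt f a = 0 := by
      simp [analyticOrderNatAt, analyticOrderAt_eq_zero.2 (Or.inr hne)]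
    exact absurd j.2 (by simp [this])
  have hfin := hf.finite_zeros_closedBall h0
  -- Multiplicity is encoded in the index type: a point that is not a zero has an empty fibre `Fin
  -- 0`.
  refine ⟨Σ a : ℂ, Fin (analyticOrderNatAt f a), fun k => k.1,
    fun R => (hfin R).toFinset.sigma fun _ => Finset.univ, ?_, hroot, ?_, ?_⟩
  · intro k hk
    exact h0 (hk ▸ hroot k)
  · intro R k
    simp [hroot k]
  · intro R
    obtain ⟨g, hg, hgZ, hfg⟩ := hf.exists_eq_prod_pow_analyticOrderNatAt_mul hord
      (hfin R).toFinset
    set Z := (hfin R).toFinset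
    have hZ0 : ∀ a ∈ Z, a ≠ 0 := by
      rintro a ha rfl
      exact h0 ((hfin R).mem_toFinset.1 ha).1
    refine ⟨fun w => (∏ a ∈ Z, (-a) ^ analyticOrderNatAt f a) * g w, by fun_prop, ?_, ?_⟩
    · intro w hw
      refine mul_ne_zero (Finset.prod_ne_zero_iff.2 fun a ha =>
        pow_ne_zero _ (neg_ne_zero.2 (hZ0 a ha))) ?_
      by_cases hfw : f w = 0
      · exact hgZ w ((hfin R).mem_toFinset.2 ⟨hfw, hw⟩)
      · intro h
        exact hfw (by rw [hfg, h, mul_zero])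
    · intro w
      rw [hfg w, Finset.prod_sigma, ← mul_assoc, ← Finset.prod_mul_distrib]
      congr 1
      refine Finset.prod_congr rfl fun a ha => ?_
      have := hZ0 a ha
      dsimp only
      rw [Finset.prod_const, Finset.card_univ, Fintype.card_fin, ← mul_pow]
      congr 1
      field_simp
      ring

/-! ### Logarithms and their linear approximation -/

/-- Take the primitive `h` of `f'/f` vanishing at 0; then `f exp(-h)` has zero derivative and equals
1 at 0. -/
theorem exists_log_of_ne_zero_on_ball {f : ℂ → ℂ} {R : ℝ} (hR : 0 < R)
    (hf : DifferentiableOn ℂ f (Metric.ball 0 R)) (hne : ∀ w ∈ Metric.ball (0 : ℂ) R, f w ≠ 0)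
    (h0 : f 0 = 1) :
    ∃ h : ℂ → ℂ, DifferentiableOn ℂ h (Metric.ball 0 R) ∧ h 0 = 0 ∧
      ∀ w ∈ Metric.ball (0 : ℂ) R, f w = Complex.exp (h w) := by
  have hop : IsOpen (Metric.ball (0 : ℂ) R) := Metric.isOpen_ball
  obtain ⟨h, hh0, hh⟩ := (((hf.deriv hop).div hf hne).isExactOn_ball).with_val_at 0 0
  refine ⟨h, fun w hw => (hh w hw).differentiableAt.differentiableWithinAt, hh0, ?_⟩
  have hd : ∀ w ∈ Metric.ball (0 : ℂ) R,
      HasDerivAt (fun w => f w * Complex.exp (-h w)) 0 w := by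
    intro w hw
    have h1 := (hf.differentiableAt (hop.mem_nhds hw)).hasDerivAt
    have h2 := h1.mul ((hh w hw).neg.cexp)
    convert! h2 using 1
    have := hne w hw
    simp only [Pi.div_apply]
    field_simp
    ring
  intro w hw
  have := (convex_ball (0 : ℂ) R).is_const_of_fderivWithin_eq_zero (𝕜 := ℂ)
    (f := fun w => f w * Complex.exp (-h w))
    (fun w hw => (hd w hw).differentiableAt.differentiableWithinAt)
    (fun w hw => by
      rw [fderivWithin_of_isOpen hop hw, (hd w hw).hasFDerivAt.fderiv]
      ext; simp) hw (Metric.mem_ball_self hR)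
  simp only [hh0, h0, neg_zero, Complex.exp_zero, mul_one] at this
  rw [Complex.exp_neg] at this
  exact (mul_inv_eq_one₀ (Complex.exp_ne_zero _)).1 this

/-- Borel–Carathéodory gives `‖h‖ ≤ 2B` on the half disc, and two applications of the Schwarz lemma,
to `h` and to its difference quotient, each gain a factor `‖w‖ / (R/2)`. -/
theorem norm_sub_deriv_mul_le_of_re_le {h : ℂ → ℂ} {R B : ℝ} (hR : 0 < R) (hB : 0 < B)
    (hh : DifferentiableOn ℂ h (Metric.ball 0 R)) (h0 : h 0 = 0)
    (hre : ∀ w ∈ Metric.ball (0 : ℂ) R, (h w).re ≤ B) {w : ℂ} (hw : ‖w‖ < R / 2) :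
    ‖h w - deriv h 0 * w‖ ≤ 16 * B * ‖w‖ ^ 2 / R ^ 2 := by
  have hR2 : 0 < R / 2 := by positivity
  have hsub : Metric.ball (0 : ℂ) (R / 2) ⊆ Metric.ball 0 R :=
    Metric.ball_subset_ball (by linarith)
  have hb : ∀ v ∈ Metric.ball (0 : ℂ) (R / 2), ‖h v‖ ≤ 2 * B := by
    intro v hv
    have hv' : ‖v‖ < R / 2 := by simpa using hv
    refine (Complex.borelCaratheodory_zero hB hh hre hR (hsub hv) h0).trans ?_
    rw [div_le_iff₀ (by linarith)]
    nlinarith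
  have hnhds : Metric.ball (0 : ℂ) (R / 2) ∈ 𝓝 0 := Metric.ball_mem_nhds _ hR2
  have hd1 : DifferentiableOn ℂ h (Metric.ball 0 (R / 2)) := hh.mono hsub
  have hs1 : ∀ v ∈ Metric.ball (0 : ℂ) (R / 2), ‖dslope h 0 v‖ ≤ 2 * B / (R / 2) := fun v hv =>
    Complex.norm_dslope_le_div_of_mapsTo_ball hd1 (fun v hv => by simpa [h0] using hb v hv) hv
  have hd2 : DifferentiableOn ℂ (dslope h 0) (Metric.ball 0 (R / 2)) :=
    (Complex.differentiableOn_dslope hnhds).2 hd1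
  have hw' : w ∈ Metric.ball (0 : ℂ) (R / 2) := by simpa using hw
  have hs2 := Complex.norm_dslope_le_div_of_mapsTo_ball (R₂ := 2 * (2 * B / (R / 2))) hd2
    (fun v hv => by
      rw [mem_closedBall_iff_norm]
      refine (norm_sub_le _ _).trans ?_
      have h1 := hs1 v hv
      have h2 := hs1 0 (Metric.mem_ball_self hR2)
      linarith) hw'
  have e1 := sub_smul_dslope h 0 w
  have e2 := sub_smul_dslope (dslope h 0) 0 w
  simp only [sub_zero, smul_eq_mul, h0, dslope_same] at e1 e2
  have : h w - deriv h 0 * w = w ^ 2 * dslope (dslope h 0) 0 w := by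
    rw [← e1, eq_add_of_sub_eq e2.symm]; ring
  rw [this, norm_mul, norm_pow]
  calc ‖w‖ ^ 2 * ‖dslope (dslope h 0) 0 w‖
      ≤ ‖w‖ ^ 2 * (2 * (2 * B / (R / 2)) / (R / 2)) := by gcongr
    _ = 16 * B * ‖w‖ ^ 2 / R ^ 2 := by field_simp; ring

/-! ### Counting zeros and summability of their inverse squares -/

namespace IsZeroEnumeration

variable {f : ℂ → ℂ} {ι : Type} {a : ι → ℂ} {S : ℝ → Finset ι}

/-- On the circle of radius `3R` every factor with `‖a k‖ ≤ R` has modulus at least `3 - 1 = 2`; the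
maximum principle carries the resulting bound on `K` inside. At 0 it bounds the number of zeros,
elsewhere it bounds the quotient. -/
theorem two_pow_card_mul_norm_le (h : IsZeroEnumeration f a S) {R B : ℝ} (hR : 0 < R)
    (hB : ∀ w : ℂ, ‖w‖ = 3 * R → ‖f w‖ ≤ B) {K : ℂ → ℂ} (hK : Differentiable ℂ K)
    (hfK : ∀ w, f w = (∏ k ∈ S R, (1 - w / a k)) * K w) {w : ℂ} (hw : ‖w‖ ≤ 3 * R) :
    2 ^ (S R).card * ‖K w‖ ≤ B := by
  have key : ‖K w‖ ≤ B / 2 ^ (S R).card := by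
    refine Complex.norm_le_of_forall_mem_frontier_norm_le (U := Metric.ball 0 (3 * R))
      Metric.isBounded_ball hK.diffContOnCl (fun v hv => ?_) ?_
    · rw [frontier_ball _ (by positivity), mem_sphere_zero_iff_norm] at hv
      rw [le_div_iff₀' (by positivity)]
      refine le_trans ?_ (hB v hv)
      rw [hfK, norm_mul, norm_prod, ← Finset.prod_const]
      gcongr with k hk
      have hak : 0 < ‖a k‖ := norm_pos_iff.2 (h.ne_zero k)
      have hakR := (h.mem_iff R k).1 hk
      have h3 : 3 ≤ ‖v / a k‖ := by
        rw [norm_div, hv, le_div_iff₀ hak]; linarith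
      have := norm_sub_norm_le (v / a k) 1
      rw [norm_one, norm_sub_rev] at this
      linarith
    · rw [closure_ball _ (by positivity)]; simpa using hw
  rwa [le_div_iff₀' (by positivity)] at key

theorem card_le_rpow (h : IsZeroEnumeration f a S) (h0 : f 0 = 1) {C p : ℝ}
    (hgrowth : ∀ᶠ r : ℝ in atTop, ∀ w : ℂ, ‖w‖ = r → ‖f w‖ ≤ Real.exp (C * r ^ p)) :
    ∀ᶠ R : ℝ in atTop, ((S R).card : ℝ) ≤ C * 3 ^ p / Real.log 2 * R ^ p := by
  have ht : Tendsto (fun R : ℝ => 3 * R) atTop atTop := tendsto_id.const_mul_atTop (by norm_num)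
  filter_upwards [ht.eventually hgrowth, eventually_gt_atTop 0] with R hR hR0
  obtain ⟨K, hK, -, hfK⟩ := h.exists_factor R
  have h1 := h.two_pow_card_mul_norm_le hR0 hR hK hfK (w := 0) (by simp; positivity)
  have hK0 : K 0 = 1 := by have := hfK 0; simpa [h0] using this.symm
  rw [hK0, norm_one, mul_one] at h1
  have h2 := Real.log_le_log (by positivity) h1
  rw [Real.log_exp, Real.log_pow, Real.mul_rpow (by norm_num) hR0.le] at h2
  have hl : 0 < Real.log 2 := Real.log_pos (by norm_num)
  rw [div_mul_eq_mul_div, le_div_iff₀ hl]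
  linarith

theorem summable_inv_sq_of_card_le (h : IsZeroEnumeration f a S) {D p : ℝ} (hp : p < 2)
    (hcard : ∀ᶠ R : ℝ in atTop, ((S R).card : ℝ) ≤ D * R ^ p) :
    Summable fun k => (‖a k‖ ^ 2)⁻¹ := by
  classical
  -- Dyadic counting: the weight `4^(-j)` is given to every zero in the disc of radius `2^j`. Summed
  -- over `k`, row `j` is eventually at most `D (2^p / 4)^j`, a convergent geometric series. Summed
  -- over `j`, a zero with `2^n ≤ ‖a k‖ < 2^(n+1)` receives at least `4^(-(n+1))`, hence at least a
  -- quarter of `‖a k‖^(-2)`.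
  obtain ⟨g, hg⟩ : ∃ g : ℕ × ι → ℝ, ∀ j k,
      g (j, k) = if k ∈ S (2 ^ j) then ((4 : ℝ) ^ j)⁻¹ else 0 :=
    ⟨fun x => if x.2 ∈ S (2 ^ x.1) then ((4 : ℝ) ^ x.1)⁻¹ else 0, fun _ _ => rfl⟩
  have hg0 : ∀ x, 0 ≤ g x := by
    rintro ⟨j, k⟩
    rw [hg]; split_ifs <;> positivity
  have hrow : ∀ j, HasSum (fun k => g (j, k)) ((S (2 ^ j)).card * ((4 : ℝ) ^ j)⁻¹) := by
    intro j
    have := hasSum_sum_of_ne_finset_zero (L := .unconditional ι)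
      (f := fun k => g (j, k)) (s := S (2 ^ j))
      (fun k hk => by simp [hg, hk])
    convert this using 1
    rw [Finset.sum_congr rfl (g := fun _ => ((4 : ℝ) ^ j)⁻¹) (fun k hk => by simp [hg, hk])]
    simp
  have hgsum : Summable g := by
    rw [summable_prod_of_nonneg hg0]
    refine ⟨fun j => (hrow j).summable, ?_⟩
    simp only [fun j => (hrow j).tsum_eq]
    have hq : Summable fun j : ℕ => D * ((2 : ℝ) ^ p / 4) ^ j := by
      refine (summable_geometric_of_lt_one (by positivity) ?_).mul_left _
      rw [div_lt_one (by norm_num)]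
      calc (2 : ℝ) ^ p < 2 ^ (2 : ℝ) := Real.rpow_lt_rpow_of_exponent_lt (by norm_num) hp
        _ = 4 := by norm_num
    refine hq.of_norm_bounded_eventually_nat ?_
    have ht : Tendsto (fun j : ℕ => (2 : ℝ) ^ j) atTop atTop :=
      tendsto_pow_atTop_atTop_of_one_lt (by norm_num)
    filter_upwards [ht.eventually hcard] with j hj
    rw [Real.norm_of_nonneg (by positivity), div_pow, ← div_eq_mul_inv, ← mul_div_assoc]
    gcongr
    rwa [← Real.rpow_natCast, ← Real.rpow_mul (by norm_num), mul_comm (j : ℝ) p,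
      Real.rpow_mul (by norm_num), Real.rpow_natCast, Real.rpow_natCast] at hj
  have hsw : Summable fun x : ι × ℕ => g x.swap :=
    (Equiv.prodComm ι ℕ).summable_iff.2 hgsum
  refine (hsw.prod.mul_left 4).of_norm_bounded_eventually ?_
  have hcof : ∀ᶠ k in cofinite, k ∉ S 1 := by simp
  filter_upwards [hcof] with k hk
  rw [h.mem_iff, not_le] at hk
  obtain ⟨n, hn1, hn2⟩ := exists_nat_pow_near hk.le (one_lt_two (α := ℝ))
  have hle : g (n + 1, k) ≤ ∑' j, g (j, k) := by
    have := (hsw.comp_injective (Prod.mk_right_injective k)).le_tsum (n + 1) (fun _ _ => hg0 _)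
    exact this
  have hgk : g (n + 1, k) = ((4 : ℝ) ^ (n + 1))⁻¹ := by
    rw [hg, if_pos ((h.mem_iff _ _).2 hn2.le)]
  rw [Real.norm_of_nonneg (by positivity)]
  calc (‖a k‖ ^ 2)⁻¹ ≤ (((2 : ℝ) ^ n) ^ 2)⁻¹ := by gcongr
    _ = 4 * g (n + 1, k) := by
      have : ((2 : ℝ) ^ n) ^ 2 = 4 ^ n := by rw [← pow_mul, mul_comm, pow_mul]; norm_num
      rw [hgk, this, pow_succ]; field_simp
    _ ≤ _ := by gcongr; exact hle

theorem summable_inv_sq (h : IsZeroEnumeration f a S) (h0 : f 0 = 1) {C p : ℝ} (hp : p < 2)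
    (hgrowth : ∀ᶠ r : ℝ in atTop, ∀ w : ℂ, ‖w‖ = r → ‖f w‖ ≤ Real.exp (C * r ^ p)) :
    Summable fun k => (‖a k‖ ^ 2)⁻¹ :=
  h.summable_inv_sq_of_card_le hp (h.card_le_rpow h0 hgrowth)

end IsZeroEnumeration

/-! ### Hadamard factorization in genus one -/

theorem norm_one_sub_mul_exp_sub_one_le {u : ℂ} (hu : ‖u‖ ≤ 1) :
    ‖(1 - u) * Complex.exp u - 1‖ ≤ 3 * ‖u‖ ^ 2 := by
  have e : (1 - u) * Complex.exp u - 1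
      = (Complex.exp u - 1 - u) - u * (Complex.exp u - 1) := by ring
  have h1 := Complex.norm_exp_sub_one_sub_id_le hu
  have h2 := Complex.norm_exp_sub_one_le hu
  rw [e]
  calc _ ≤ ‖Complex.exp u - 1 - u‖ + ‖u * (Complex.exp u - 1)‖ := norm_sub_le _ _
    _ ≤ ‖u‖ ^ 2 + ‖u‖ * (2 * ‖u‖) := by rw [norm_mul]; gcongr
    _ = _ := by ring

theorem hasProdLocallyUniformly_one_sub_mul_exp {ι : Type} {a : ι → ℂ}
    (ha : Summable fun k => (‖a k‖ ^ 2)⁻¹) :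
    HasProdLocallyUniformly (fun k w => (1 - w / a k) * Complex.exp (w / a k))
      (fun w => ∏' k, (1 - w / a k) * Complex.exp (w / a k)) := by
  refine hasProdLocallyUniformly_of_forall_compact fun s hs => ?_
  obtain ⟨r, hr⟩ := hs.isBounded.exists_pos_norm_le
  have hev : ∀ᶠ k in cofinite, r ^ 2 * (‖a k‖ ^ 2)⁻¹ ≤ 1 :=
    (((ha.mul_left (r ^ 2)).tendsto_cofinite_zero).eventually (ge_mem_nhds one_pos))
  have := (ha.mul_left (3 * r ^ 2)).hasProdUniformlyOn_one_add (K := s)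
    (f := fun k w => (1 - w / a k) * Complex.exp (w / a k) - 1) hs ?_
    (fun k => by fun_prop)
  · simpa only [add_sub_cancel] using this
  · filter_upwards [hev] with k hk w hw
    have hu : ‖w / a k‖ ^ 2 ≤ r ^ 2 * (‖a k‖ ^ 2)⁻¹ := by
      rw [norm_div, div_pow, div_eq_mul_inv]
      gcongr
      exact hr.2 w hw
    refine (norm_one_sub_mul_exp_sub_one_le ?_).trans ?_
    · exact (sq_le_one_iff₀ (norm_nonneg _)).1 (hu.trans hk)
    · rw [mul_assoc]; gcongr

theorem IsZeroEnumeration.eq_exp_mul_tprod {f : ℂ → ℂ} {ι : Type} {a : ι → ℂ}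
    {S : ℝ → Finset ι} (h : IsZeroEnumeration f a S) (h0 : f 0 = 1) {C p : ℝ} (hC : 0 < C)
    (hp : p < 2)
    (hgrowth : ∀ᶠ r : ℝ in atTop, ∀ w : ℂ, ‖w‖ = r → ‖f w‖ ≤ Real.exp (C * r ^ p)) (w : ℂ) :
    f w = Complex.exp (deriv f 0 * w) * ∏' k, (1 - w / a k) * Complex.exp (w / a k) := by
  classical
  have hsum := h.summable_inv_sq h0 hp hgrowth
  have hprod := (hasProdLocallyUniformly_one_sub_mul_exp hsum).hasProd (x := w)
  have hS : Tendsto S atTop atTop := by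
    refine tendsto_atTop_finset_of_monotone (fun R R' hRR k hk => ?_) fun k => ⟨‖a k‖, ?_⟩
    · rw [h.mem_iff] at hk ⊢; exact hk.trans hRR
    · rw [h.mem_iff]
  have hQ := hprod.comp hS
  have ht : Tendsto (fun R : ℝ => 3 * R) atTop atTop := tendsto_id.const_mul_atTop (by norm_num)
  -- Here `e` is the deviation of the logarithm of the quotient from its linear part; the bound
  -- tends to 0 because `p < 2`.
  have hfact : ∀ᶠ R : ℝ in atTop, ∃ e : ℂ, ‖e‖ ≤ 16 * C * 3 ^ p * ‖w‖ ^ 2 * R ^ (p - 2) ∧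
      f w = Complex.exp (deriv f 0 * w) *
        (∏ k ∈ S R, (1 - w / a k) * Complex.exp (w / a k)) * Complex.exp e := by
    filter_upwards [ht.eventually hgrowth, eventually_gt_atTop 0, eventually_gt_atTop (2 * ‖w‖)]
      with R hR hR0 hRw
    obtain ⟨K, hK, hKne, hfK⟩ := h.exists_factor R
    have hK0 : K 0 = 1 := by have := hfK 0; simpa [h0] using this.symm
    have hKb : ∀ v ∈ Metric.ball (0 : ℂ) R, ‖K v‖ ≤ Real.exp (C * (3 * R) ^ p) := by
      intro v hv
      have hv' : ‖v‖ < R := by simpa using hv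
      refine le_trans ?_ (h.two_pow_card_mul_norm_le hR0 hR hK hfK (w := v) (by linarith))
      exact le_mul_of_one_le_left (norm_nonneg _) (one_le_pow₀ (by norm_num))
    obtain ⟨l, hl, hl0, hKl⟩ := exists_log_of_ne_zero_on_ball hR0 hK.differentiableOn
      (fun v hv => hKne v (by simpa using (Metric.mem_ball.1 hv).le)) hK0
    have hre : ∀ v ∈ Metric.ball (0 : ℂ) R, (l v).re ≤ C * (3 * R) ^ p := by
      intro v hv
      have := hKb v hv
      rwa [hKl v hv, Complex.norm_exp, Real.exp_le_exp] at this
    have hest := norm_sub_deriv_mul_le_of_re_le hR0 (by positivity) hl hl0 hre (w := w)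
      (by linarith)
    have hball : Metric.ball (0 : ℂ) R ∈ 𝓝 (0 : ℂ) := Metric.ball_mem_nhds _ hR0
    -- The logarithmic derivative at 0. It turns the linear part of `l` into `deriv f 0`,
    -- independent of `R`, plus exactly the exponents of the convergence factors.
    have hderiv : deriv f 0 = deriv l 0 - ∑ k ∈ S R, (a k)⁻¹ := by
      have h1 : HasDerivAt l (deriv l 0) 0 := (hl.differentiableAt hball).hasDerivAt
      have h2 : HasDerivAt (fun v => ∏ k ∈ S R, (1 - v / a k)) (- ∑ k ∈ S R, (a k)⁻¹) 0 := by
        have := HasDerivAt.fun_finsetProd (u := S R) (f := fun k v => 1 - v / a k)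
          (f' := fun k => -(1 / a k)) (x := (0 : ℂ))
          (fun k _ => ((hasDerivAt_id (0 : ℂ)).div_const (a k)).const_sub 1)
        convert! this using 1
        simp
      have h3 := h2.mul h1.cexp
      have h4 : f =ᶠ[𝓝 0] (fun v => ∏ k ∈ S R, (1 - v / a k)) * fun v => Complex.exp (l v) := by
        filter_upwards [hball] with v hv
        rw [hfK v, Pi.mul_apply, hKl v hv]
      rw [h4.deriv_eq, h3.deriv]
      simp [hl0]
      ring
    refine ⟨l w - deriv l 0 * w, hest.trans_eq ?_, ?_⟩
    · rw [Real.mul_rpow (by norm_num) hR0.le, Real.rpow_sub hR0, Real.rpow_two]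
      field_simp
    · rw [hfK w, hKl w (by simp; linarith [norm_nonneg w]), Finset.prod_mul_distrib,
        ← Complex.exp_sum, hderiv]
      have : ∀ u v x P : ℂ, Complex.exp u * (P * Complex.exp v) * Complex.exp x
          = P * Complex.exp (u + v + x) := by
        intro u v x P; rw [Complex.exp_add, Complex.exp_add]; ring
      rw [this]
      congr 2
      simp only [div_eq_mul_inv, ← Finset.mul_sum]
      ring
  obtain ⟨e, he⟩ := hfact.choice
  have he0 : Tendsto e atTop (𝓝 0) := by
    refine squeeze_zero_norm' (he.mono fun R hR => hR.1) ?_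
    have := (tendsto_rpow_neg_atTop (y := 2 - p) (by linarith)).const_mul
      (16 * C * 3 ^ p * ‖w‖ ^ 2)
    simpa only [neg_sub, mul_zero] using this
  have hlim := (hQ.const_mul (Complex.exp (deriv f 0 * w))).mul he0.cexp
  rw [Complex.exp_zero, mul_one] at hlim
  refine tendsto_nhds_unique ?_ hlim
  exact tendsto_const_nhds.congr' (he.mono fun R hR => hR.2)

theorem eventually_norm_le_exp_of_growthOrder_le {F : ℂ → ℂ} (hF : Continuous F)
    (hord : growthOrder F ≤ 1) {p : ℝ} (hp : 1 < p) :
    ∀ᶠ r : ℝ in atTop, ∀ w : ℂ, ‖w‖ = r → ‖F w‖ ≤ Real.exp (r ^ p) := by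
  have hlt : growthOrder F < (p : EReal) := hord.trans_lt (by exact_mod_cast hp)
  filter_upwards [eventually_lt_of_limsup_lt hlt, eventually_gt_atTop 1] with r hr hr1 w hw
  have hr' : Real.log (Real.log (maxModulus F r)) / Real.log r < p := by exact_mod_cast hr
  have hr0 : 0 < r := by linarith
  have hle : ‖F w‖ ≤ maxModulus F r := by
    refine le_csSup ?_ ⟨w, by simp [hw], rfl⟩
    exact ((isCompact_closedBall (0 : ℂ) r).image hF.norm).bddAbove
  refine hle.trans ?_
  -- For `maxModulus F r ≤ 1` the iterated real logarithm says nothing useful about growth, but the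
  -- bound is then trivial.
  rcases le_or_gt (maxModulus F r) 1 with hM | hM
  · exact hM.trans (Real.one_le_exp (by positivity))
  · have hl : 0 < Real.log (maxModulus F r) := Real.log_pos hM
    rw [← Real.log_le_iff_le_exp (by linarith), ← Real.log_le_log_iff hl (by positivity),
      Real.log_rpow hr0]
    rw [div_lt_iff₀ (Real.log_pos hr1)] at hr'
    exact hr'.le

theorem exists_isWeierstrassFactorization {F : ℂ → ℂ} (hF : Differentiable ℂ F)
    (hord : growthOrder F ≤ 1) (hroots : ∀ w : ℂ, w ≠ 0 → F w = 0 → w.re = 0) :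
    ∃ (lam alpha : ℂ) (n : ℕ) (ι : Type) (z : ι → ℝ),
      IsWeierstrassFactorization F lam alpha n z := by
  -- The point 1 is not purely imaginary, so `F` is not identically zero.
  have hF1 : F 1 ≠ 0 := fun h => by simpa using hroots 1 one_ne_zero h
  obtain ⟨g, hg, hg0, hFg⟩ :=
    hF.exists_eq_pow_analyticOrderNatAt_mul (hF.analyticOrderAt_ne_top hF1 0)
  set n := analyticOrderNatAt F 0
  simp only [sub_zero] at hFg
  set f : ℂ → ℂ := fun w => (g 0)⁻¹ * g w with hf
  have hfd : Differentiable ℂ f := by fun_prop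
  have hf0 : f 0 = 1 := by simp [hf, hg0]
  have hFf : ∀ w, F w = g 0 * w ^ n * f w := fun w => by
    rw [hFg, hf]; field_simp
  obtain ⟨ι, a, S, h⟩ := hfd.exists_isZeroEnumeration (by simp [hf0])
  -- Any exponent strictly between 1 and 2 would serve; the factor 2 absorbs the normalizing
  -- constant `‖g 0‖⁻¹`.
  have hgrowth : ∀ᶠ r : ℝ in atTop, ∀ w : ℂ, ‖w‖ = r →
      ‖f w‖ ≤ Real.exp (2 * r ^ (3 / 2 : ℝ)) := by
    have ht : Tendsto (fun r : ℝ => Real.exp (r ^ (3 / 2 : ℝ))) atTop atTop :=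
      Real.tendsto_exp_atTop.comp (tendsto_rpow_atTop (by norm_num))
    filter_upwards [eventually_norm_le_exp_of_growthOrder_le hF.continuous hord
      (p := 3 / 2) (by norm_num), ht.eventually_ge_atTop ‖g 0‖⁻¹, eventually_ge_atTop 1]
      with r hr hr2 hr1 w hw
    have h1 := hr w hw
    rw [hFg, norm_mul, norm_pow, hw] at h1
    have h2 : ‖g w‖ ≤ Real.exp (r ^ (3 / 2 : ℝ)) :=
      (le_mul_of_one_le_left (norm_nonneg _) (one_le_pow₀ hr1)).trans h1
    rw [hf, norm_mul, norm_inv, two_mul, Real.exp_add]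
    gcongr
  have hsum := h.summable_inv_sq hf0 (by norm_num) hgrowth
  have hre : ∀ k, (a k).re = 0 := fun k => hroots _ (h.ne_zero k) (by
    rw [hFf, h.isRoot, mul_zero])
  -- The sign `z_k = -Im a_k` is forced by requiring `i w / z_k = w / a_k`.
  have haz : ∀ k, a k = -(Complex.I * ((-(a k).im : ℝ) : ℂ)) := fun k => by
    apply Complex.ext <;> simp [hre k]
  have hzne : ∀ k, -(a k).im ≠ 0 := fun k h0 => h.ne_zero k (by
    rw [haz k, h0]; simp)
  have hdiv : ∀ k w, Complex.I * w / ((-(a k).im : ℝ) : ℂ) = w / a k := by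
    intro k w
    conv_rhs => rw [haz k]
    have h1 : ((-(a k).im : ℝ) : ℂ) ≠ 0 := by exact_mod_cast hzne k
    rw [div_eq_div_iff h1 (by simpa using h1)]
    linear_combination (-w * ((-(a k).im : ℝ) : ℂ)) * Complex.I_mul_I
  have hcount : Countable ι := by
    have : (Set.univ : Set ι) = ⋃ m : ℕ, (S m : Set ι) := by
      ext k
      obtain ⟨m, hm⟩ := exists_nat_ge ‖a k‖
      simpa [h.mem_iff] using ⟨m, hm⟩
    rw [← Set.countable_univ_iff, this]
    exact Set.countable_iUnion fun m => (S m).countable_toSet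
  refine ⟨g 0, deriv f 0, n, ι, fun k => -(a k).im, hcount, hzne, hg0, ?_,
    fun w => ∏' k, (1 - w / a k) * Complex.exp (w / a k), ?_, ?_⟩
  · refine (hg.continuous.tendsto 0 |>.mono_left nhdsWithin_le_nhds).congr' ?_
    filter_upwards [self_mem_nhdsWithin] with w hw
    have : w ≠ 0 := hw
    rw [hFg]; field_simp
  · simp only [hdiv]
    exact hasProdLocallyUniformly_one_sub_mul_exp hsum
  · intro w
    rw [hFf, h.eq_exp_mul_tprod hf0 (by norm_num) (by norm_num) hgrowth w]
    ring

/-! ### The entire functional calculus -/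

section EntireCalculus

variable {E : Type*} [NormedAddCommGroup E] [NormedSpace ℂ E]

theorem hasSum_taylorCoeff {F : ℂ → ℂ} (hF : Differentiable ℂ F) (w : ℂ) :
    HasSum (fun k => taylorCoeff F k * w ^ k) (F w) := by
  have h := Complex.hasSum_taylorSeries_of_entire hF 0 w
  refine h.congr_fun fun k => ?_
  simp only [taylorCoeff, sub_zero, smul_eq_mul]
  ring

/-- Uniqueness of power series. Through it, every algebraic rule of the calculus reduces to
exhibiting a scalar expansion and the matching operator expansion. -/
theorem taylorCoeff_eq_of_hasSum {F : ℂ → ℂ} (hF : Differentiable ℂ F) {c : ℕ → ℂ}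
    (h : ∀ w, HasSum (fun k => c k * w ^ k) (F w)) (k : ℕ) : taylorCoeff F k = c k := by
  have key : ∀ d : ℕ → ℂ, (∀ w, HasSum (fun k => d k * w ^ k) (F w)) →
      HasFPowerSeriesAt F (FormalMultilinearSeries.ofScalars ℂ d) 0 := by
    intro d hd
    rw [hasFPowerSeriesAt_iff]
    refine Eventually.of_forall fun w => ?_
    simpa [FormalMultilinearSeries.coeff_ofScalars, mul_comm] using hd w
  have := (key _ (hasSum_taylorCoeff hF)).eq_formalMultilinearSeries (key c h)
  have h2 := congrArg (fun p => FormalMultilinearSeries.coeff p k) this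
  simpa only [FormalMultilinearSeries.coeff_ofScalars] using h2

theorem entireCalculus_eq_of_hasSum {F : ℂ → ℂ} (hF : Differentiable ℂ F) {c : ℕ → ℂ}
    (h : ∀ w, HasSum (fun k => c k * w ^ k) (F w)) (A : E →L[ℂ] E) {B : E →L[ℂ] E}
    (hB : HasSum (fun k => c k • A ^ k) B) : entireCalculus F A = B := by
  refine HasSum.tsum_eq ?_
  simpa only [taylorCoeff_eq_of_hasSum hF h] using hB

theorem summable_norm_taylorCoeff_smul_pow {F : ℂ → ℂ} (hF : Differentiable ℂ F)
    (A : E →L[ℂ] E) : Summable fun k => ‖taylorCoeff F k • A ^ k‖ := by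
  refine (summable_norm_taylorCoeff_mul_pow hF ‖A‖).of_norm_bounded_eventually_nat ?_
  filter_upwards [eventually_gt_atTop 0] with k hk
  rw [norm_norm, norm_smul, abs_norm]
  exact mul_le_mul_of_nonneg_left (norm_pow_le' A hk) (norm_nonneg _)

theorem entireCalculus_pow (n : ℕ) (A : E →L[ℂ] E) :
    entireCalculus (fun w => w ^ n) A = A ^ n := by
  refine entireCalculus_eq_of_hasSum (differentiable_pow n) (c := Pi.single n 1)
    (fun w => ?_) A ?_
  · convert hasSum_single n (f := fun k => (Pi.single n 1 : ℕ → ℂ) k * w ^ k)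
      (fun k hk => by simp [hk]) using 1
    simp
  · convert hasSum_single n (f := fun k => (Pi.single n 1 : ℕ → ℂ) k • A ^ k)
      (fun k hk => by simp [hk]) using 1
    simp

theorem entireCalculus_one (A : E →L[ℂ] E) : entireCalculus (fun _ => 1) A = 1 := by
  simpa using entireCalculus_pow 0 A

/-- Cauchy's estimates on the circle of radius `2‖A‖ + 1` dominate the series by a geometric one of
ratio `1/2`; the `+ 1` keeps the radius positive when `A = 0`. -/
theorem norm_entireCalculus_le {F : ℂ → ℂ} (hF : Differentiable ℂ F) (A : E →L[ℂ] E) {C : ℝ}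
    (hC : ∀ w : ℂ, ‖w‖ = 2 * ‖A‖ + 1 → ‖F w‖ ≤ C) : ‖entireCalculus F A‖ ≤ 2 * C := by
  set R := 2 * ‖A‖ + 1
  have hR : 0 < R := by positivity
  have hC0 : 0 ≤ C := (norm_nonneg _).trans (hC R (by simp [abs_of_pos hR]))
  have hcoef : ∀ k, ‖taylorCoeff F k‖ ≤ C / R ^ k := by
    intro k
    have := Complex.norm_iteratedDeriv_le_of_forall_mem_sphere_norm_le (f := F) (c := 0) k hR
      hF.diffContOnCl (fun w hw => hC w (by simpa using hw))
    rw [taylorCoeff, norm_mul, norm_inv, Complex.norm_natCast, inv_mul_le_iff₀ (by positivity)]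
    rwa [← mul_div_assoc]
  have hterm : ∀ k, ‖taylorCoeff F k • A ^ k‖ ≤ C * (1 / 2) ^ k := by
    intro k
    have hA : ‖A ^ k‖ ≤ ‖A‖ ^ k := by
      rcases k.eq_zero_or_pos with rfl | hk
      · rw [pow_zero, pow_zero]
        exact ContinuousLinearMap.norm_id_le
      · exact norm_pow_le' A hk
    rw [norm_smul]
    calc ‖taylorCoeff F k‖ * ‖A ^ k‖ ≤ C / R ^ k * ‖A‖ ^ k := by
          gcongr
          exact hcoef k
      _ = C * (‖A‖ / R) ^ k := by rw [div_pow]; ring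
      _ ≤ C * (1 / 2) ^ k := by
          have : ‖A‖ / R ≤ 1 / 2 := by rw [div_le_iff₀ hR]; linarith
          gcongr
  have := tsum_of_norm_bounded ((hasSum_geometric_two).mul_left C) hterm
  rw [mul_comm] at this
  exact this

variable [CompleteSpace E]

/-- Both the scalar and the operator series converge absolutely, so each product is a Cauchy
product, with the same coefficients. -/
theorem entireCalculus_mul {F G : ℂ → ℂ} (hF : Differentiable ℂ F) (hG : Differentiable ℂ G)
    (A : E →L[ℂ] E) :
    entireCalculus (fun w => F w * G w) A = entireCalculus F A * entireCalculus G A := by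
  refine entireCalculus_eq_of_hasSum (hF.mul hG)
    (c := fun m => ∑ kl ∈ Finset.HasAntidiagonal.antidiagonal m,
      taylorCoeff F kl.1 * taylorCoeff G kl.2) ?_ A ?_
  · intro w
    have hs := fun {F : ℂ → ℂ} (hF : Differentiable ℂ F) => (hasSum_taylorCoeff hF w).summable.norm
    have := (summable_norm_sum_mul_antidiagonal_of_summable_norm (hs hF) (hs hG)).of_norm.hasSum
    rw [← tsum_mul_tsum_eq_tsum_sum_antidiagonal_of_summable_norm (hs hF) (hs hG),
      (hasSum_taylorCoeff hF w).tsum_eq, (hasSum_taylorCoeff hG w).tsum_eq] at this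
    refine this.congr_fun fun m => ?_
    rw [Finset.sum_mul]
    refine Finset.sum_congr rfl fun kl hkl => ?_
    rw [← Finset.HasAntidiagonal.mem_antidiagonal.1 hkl, pow_add]
    ring
  · have hs := fun {F : ℂ → ℂ} (hF : Differentiable ℂ F) => summable_norm_taylorCoeff_smul_pow hF A
    have := (summable_norm_sum_mul_antidiagonal_of_summable_norm (hs hF) (hs hG)).of_norm.hasSum
    rw [← tsum_mul_tsum_eq_tsum_sum_antidiagonal_of_summable_norm (hs hF) (hs hG)] at this
    refine this.congr_fun fun m => ?_
    rw [Finset.sum_smul]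
    refine Finset.sum_congr rfl fun kl hkl => ?_
    rw [← Finset.HasAntidiagonal.mem_antidiagonal.1 hkl, pow_add, smul_mul_smul_comm]

theorem entireCalculus_const_mul {F : ℂ → ℂ} (hF : Differentiable ℂ F) (c : ℂ)
    (A : E →L[ℂ] E) : entireCalculus (fun w => c * F w) A = c • entireCalculus F A := by
  refine entireCalculus_eq_of_hasSum (hF.const_mul c) (c := fun k => c * taylorCoeff F k)
    (fun w => ?_) A ?_
  · simpa only [mul_assoc] using (hasSum_taylorCoeff hF w).mul_left c
  · simpa only [mul_smul] using (entireCalculus_hasSum hF A).const_smul c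

theorem entireCalculus_sub {F G : ℂ → ℂ} (hF : Differentiable ℂ F) (hG : Differentiable ℂ G)
    (A : E →L[ℂ] E) :
    entireCalculus (fun w => F w - G w) A = entireCalculus F A - entireCalculus G A := by
  refine entireCalculus_eq_of_hasSum (hF.fun_sub hG)
    (c := fun k => taylorCoeff F k - taylorCoeff G k) (fun w => ?_) A ?_
  · simpa only [sub_mul] using HasSum.sub (hasSum_taylorCoeff hF w) (hasSum_taylorCoeff hG w)
  · simpa only [sub_smul] using (entireCalculus_hasSum hF A).sub (entireCalculus_hasSum hG A)

theorem entireCalculus_one_sub_mul (c : ℂ) (A : E →L[ℂ] E) :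
    entireCalculus (fun w => 1 - c * w) A = 1 - c • A := by
  have hid : entireCalculus (fun w => w) A = A := by simpa using entireCalculus_pow 1 A
  rw [entireCalculus_sub (by fun_prop) (by fun_prop), entireCalculus_one,
    entireCalculus_const_mul differentiable_fun_id, hid]

theorem entireCalculus_exp (c : ℂ) (A : E →L[ℂ] E) :
    entireCalculus (fun w => Complex.exp (c * w)) A = NormedSpace.exp (c • A) := by
  refine entireCalculus_eq_of_hasSum (by fun_prop)
    (c := fun k => (k.factorial : ℂ)⁻¹ * c ^ k) (fun w => ?_) A ?_
  · have := NormedSpace.exp_series_hasSum_exp' (𝕂 := ℂ) (c * w)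
    rw [← Complex.exp_eq_exp_ℂ] at this
    simpa only [smul_eq_mul, mul_pow, mul_assoc] using this
  · have := NormedSpace.exp_series_hasSum_exp' (𝕂 := ℂ) (c • A)
    simpa only [smul_pow, smul_smul] using this

theorem tendsto_entireCalculus {κ : Type*} {l : Filter κ} {G : κ → ℂ → ℂ} {F : ℂ → ℂ}
    (hG : ∀ i, Differentiable ℂ (G i)) (hF : Differentiable ℂ F)
    (h : TendstoLocallyUniformly G F l) (A : E →L[ℂ] E) :
    Tendsto (fun i => entireCalculus (G i) A) l (𝓝 (entireCalculus F A)) := by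
  rw [Metric.tendsto_nhds]
  intro ε hε
  have hu := (tendstoLocallyUniformlyOn_iff_tendstoUniformlyOn_of_compact
    (isCompact_sphere (0 : ℂ) (2 * ‖A‖ + 1))).1 (h.tendstoLocallyUniformlyOn)
  filter_upwards [Metric.tendstoUniformlyOn_iff.1 hu (ε / 4) (by positivity)] with i hi
  rw [dist_eq_norm, ← entireCalculus_sub (hG i) hF]
  refine (norm_entireCalculus_le ((hG i).sub hF) A (C := ε / 4) fun w hw => ?_).trans_lt
    (by linarith)
  have := (hi w (by simpa using hw)).le
  rwa [dist_comm, dist_eq_norm] at this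

end EntireCalculus

/-! ### Stability of contractive inverses -/

/-- An invertible element whose inverse is a contraction. -/
def HasContractiveInverse {𝔸 : Type*} [NormedRing 𝔸] (B : 𝔸) : Prop :=
  ∃ C : 𝔸, B * C = 1 ∧ C * B = 1 ∧ ‖C‖ ≤ 1

namespace HasContractiveInverse

variable {𝔸 : Type*} [NormedRing 𝔸]

theorem one (h1 : ‖(1 : 𝔸)‖ ≤ 1) : HasContractiveInverse (1 : 𝔸) :=
  ⟨1, by simp, by simp, h1⟩

theorem mul {B B' : 𝔸} (h : HasContractiveInverse B) (h' : HasContractiveInverse B') :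
    HasContractiveInverse (B * B') := by
  obtain ⟨C, hBC, hCB, hC⟩ := h
  obtain ⟨C', hBC', hCB', hC'⟩ := h'
  refine ⟨C' * C, ?_, ?_, ?_⟩
  · rw [mul_assoc, ← mul_assoc B', hBC', one_mul, hBC]
  · rw [mul_assoc, ← mul_assoc C, hCB, one_mul, hCB']
  · exact (norm_mul_le _ _).trans (mul_le_one₀ hC' (norm_nonneg _) hC)

theorem isUnit_of_norm_sub_lt [CompleteSpace 𝔸] {B B' : 𝔸} (h : HasContractiveInverse B)
    (hBB' : ‖B - B'‖ < 1) : IsUnit B' := by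
  obtain ⟨C, hBC, hCB, hC⟩ := h
  have hlt : ‖C * (B - B')‖ < 1 :=
    (norm_mul_le _ _).trans_lt ((mul_le_of_le_one_left (norm_nonneg _) hC).trans_lt hBB')
  have hu : IsUnit (1 - C * (B - B')) := ⟨Units.oneSub _ hlt, rfl⟩
  have hB : IsUnit B := ⟨⟨B, C, hBC, hCB⟩, rfl⟩
  have : B' = B * (1 - C * (B - B')) := by
    rw [mul_sub, mul_one, ← mul_assoc, hBC, one_mul, sub_sub_cancel]
  rw [this]
  exact hB.mul hu

/-- The uniform bound on the inverses prevents degeneration: an approximant within distance 1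
already makes the limit invertible by a Neumann series, and the resolvent identity passes the norm
bound to the limit. -/
theorem of_tendsto [CompleteSpace 𝔸] {κ : Type*} {l : Filter κ} [l.NeBot] {G : κ → 𝔸} {B : 𝔸}
    (hG : ∀ i, HasContractiveInverse (G i)) (h : Tendsto G l (𝓝 B)) :
    HasContractiveInverse B := by
  have h0 : Tendsto (fun i => ‖G i - B‖) l (𝓝 0) := tendsto_iff_norm_sub_tendsto_zero.1 h
  obtain ⟨i, hi⟩ := (h0.eventually (gt_mem_nhds one_pos)).exists
  obtain ⟨U, rfl⟩ := (hG i).isUnit_of_norm_sub_lt hi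
  refine ⟨_, U.mul_inv, U.inv_mul, ?_⟩
  have hlim : Tendsto (fun i => 1 + ‖G i - U‖ * ‖(↑U⁻¹ : 𝔸)‖) l (𝓝 (1 + 0 * ‖(↑U⁻¹ : 𝔸)‖)) :=
    (h0.mul_const _).const_add 1
  rw [zero_mul, add_zero] at hlim
  refine ge_of_tendsto' hlim fun i => ?_
  obtain ⟨C, hBC, hCB, hC⟩ := hG i
  have e : (↑U⁻¹ : 𝔸) = C + C * (G i - U) * ↑U⁻¹ := by
    rw [mul_sub, hCB, sub_mul, one_mul, mul_assoc, U.mul_inv, mul_one]; abel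
  calc ‖(↑U⁻¹ : 𝔸)‖ = ‖C + C * (G i - U) * ↑U⁻¹‖ := by rw [← e]
    _ ≤ ‖C‖ + ‖C‖ * ‖G i - U‖ * ‖(↑U⁻¹ : 𝔸)‖ := (norm_add_le _ _).trans (by
        gcongr
        exact (norm_mul_le _ _).trans (by gcongr; exact norm_mul_le _ _))
    _ ≤ 1 + 1 * ‖G i - U‖ * ‖(↑U⁻¹ : 𝔸)‖ := by gcongr
    _ = _ := by rw [one_mul]

end HasContractiveInverse

/-! ### Generators of contraction groups -/

section Dissipative

variable {𝔸 : Type*} [NormedRing 𝔸] [NormedAlgebra ℂ 𝔸] [CompleteSpace 𝔸]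

theorem exp_add_smul (D : 𝔸) (s t : ℂ) :
    NormedSpace.exp ((s + t) • D) = NormedSpace.exp (s • D) * NormedSpace.exp (t • D) := by
  let := NormedAlgebra.restrictScalars ℚ ℂ 𝔸
  rw [add_smul]
  exact NormedSpace.exp_add_of_commute (((Commute.refl D).smul_left s).smul_right t)

theorem exp_smul_mul_exp_neg_smul (D : 𝔸) (s : ℂ) :
    NormedSpace.exp (s • D) * NormedSpace.exp ((-s) • D) = 1 := by
  let := NormedAlgebra.restrictScalars ℚ ℂ 𝔸
  rw [← exp_add_smul, add_neg_cancel, zero_smul, NormedSpace.exp_zero]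

theorem exp_smul_eq_exp_im_mul_exp_re (alpha : ℂ) (A : 𝔸) :
    NormedSpace.exp (alpha • A) =
      NormedSpace.exp ((Complex.I * alpha.im : ℂ) • A) *
        NormedSpace.exp ((alpha.re : ℂ) • A) := by
  rw [← exp_add_smul]
  congr 2
  conv_lhs => rw [← Complex.re_add_im alpha]
  ring

theorem HasContractiveInverse.exp_smul {D : 𝔸} (s : ℂ)
    (hs : ‖NormedSpace.exp ((-s) • D)‖ ≤ 1) :
    HasContractiveInverse (NormedSpace.exp (s • D)) :=
  ⟨_, exp_smul_mul_exp_neg_smul D s, by simpa using exp_smul_mul_exp_neg_smul D (-s), hs⟩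

/-- For `0 < t < s`, `exp(-tD) T` is the convex combination of `(1 - sD) T` and `T` with weights
`t/s` and `1 - t/s`, up to `o(t)`. Its norm is at least `‖T‖` because `exp(tD)` is a contraction;
cancel `(1 - t/s)‖T‖` and divide by `t/s`. -/
theorem norm_le_norm_one_sub_smul_mul_of_pos {D : 𝔸}
    (hD : ∀ t : ℝ, ‖NormedSpace.exp ((t : ℂ) • D)‖ ≤ 1) {s : ℝ} (hs : 0 < s) (T : 𝔸) :
    ‖T‖ ≤ ‖(1 - (s : ℂ) • D) * T‖ := by
  refine le_of_forall_pos_le_add fun ε hε => ?_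
  have hder := hasDerivAt_exp_smul_const (𝕂 := ℂ) D (0 : ℂ)
  rw [zero_smul, NormedSpace.exp_zero, one_mul, hasDerivAt_iff_isLittleO_nhds_zero] at hder
  -- The remainder `c t ‖T‖` becomes `c ‖T‖ s` after division by `t/s`.
  obtain ⟨c, hc, hcε⟩ : ∃ c : ℝ, 0 < c ∧ c * ‖T‖ * s ≤ ε := by
    refine ⟨ε / ((‖T‖ + 1) * s), by positivity, ?_⟩
    rw [div_mul_eq_mul_div, div_mul_eq_mul_div, div_le_iff₀ (by positivity)]
    nlinarith [norm_nonneg T, mul_pos hε hs]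
  have hev := hder.def hc
  have hlim : Tendsto (fun t : ℝ => -(t : ℂ)) (𝓝[>] 0) (𝓝 0) := by
    have : Tendsto (fun t : ℝ => -(t : ℂ)) (𝓝 0) (𝓝 (-((0 : ℝ) : ℂ))) :=
      (Complex.continuous_ofReal.neg).tendsto 0
    simp only [Complex.ofReal_zero, neg_zero] at this
    exact this.mono_left nhdsWithin_le_nhds
  obtain ⟨t, htev, ht0, hts⟩ := ((hlim.eventually hev).and
    (Ioo_mem_nhdsGT hs)).exists
  simp only [zero_add, zero_smul, NormedSpace.exp_zero, norm_neg, Complex.norm_real,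
    Real.norm_of_nonneg ht0.le] at htev
  set e : 𝔸 := NormedSpace.exp (-(t : ℂ) • D) - 1 - -(t : ℂ) • D with he
  have h1 : ‖T‖ ≤ ‖NormedSpace.exp (-(t : ℂ) • D) * T‖ := by
    calc ‖T‖ = ‖NormedSpace.exp ((t : ℂ) • D) * (NormedSpace.exp (-(t : ℂ) • D) * T)‖ := by
          rw [← mul_assoc, exp_smul_mul_exp_neg_smul, one_mul]
      _ ≤ 1 * _ := (norm_mul_le _ _).trans (by gcongr; exact hD t)
      _ = _ := one_mul _
  have h2 : NormedSpace.exp (-(t : ℂ) • D) * T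
      = ((t / s : ℝ) : ℂ) • ((1 - (s : ℂ) • D) * T) + ((1 - t / s : ℝ) : ℂ) • T + e * T := by
    have hts' : ((t / s : ℝ) : ℂ) * (s : ℂ) = t := by
      rw [← Complex.ofReal_mul, div_mul_cancel₀ _ hs.ne']
    rw [he, sub_mul, sub_mul, sub_mul, smul_sub, smul_mul_assoc, smul_smul, hts',
      Complex.ofReal_sub, sub_smul, one_mul, neg_smul, neg_mul, smul_mul_assoc,
      Complex.ofReal_one, one_smul]
    abel
  have hq0 : 0 < t / s := by positivity
  have hq1 : t / s < 1 := by rw [div_lt_one hs]; exact hts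
  rw [h2] at h1
  have h3 : ‖T‖ ≤ t / s * ‖(1 - (s : ℂ) • D) * T‖ + (1 - t / s) * ‖T‖ + c * t * ‖T‖ := by
    refine h1.trans ((norm_add₃_le).trans ?_)
    rw [norm_smul, norm_smul, Complex.norm_real, Complex.norm_real, Real.norm_of_nonneg hq0.le,
      Real.norm_of_nonneg (by linarith)]
    gcongr
    exact (norm_mul_le _ _).trans (by gcongr)
  have h4 : t / s * ‖T‖ ≤ t / s * (‖(1 - (s : ℂ) • D) * T‖ + c * ‖T‖ * s) := by
    have : t / s * (c * ‖T‖ * s) = c * t * ‖T‖ := by field_simp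
    rw [mul_add, this]; linarith
  have := le_of_mul_le_mul_left h4 hq0
  linarith

theorem norm_le_norm_one_sub_smul_mul {D : 𝔸}
    (hD : ∀ t : ℝ, ‖NormedSpace.exp ((t : ℂ) • D)‖ ≤ 1) (s : ℝ) (T : 𝔸) :
    ‖T‖ ≤ ‖(1 - (s : ℂ) • D) * T‖ := by
  rcases lt_trichotomy s 0 with hs | rfl | hs
  · have := norm_le_norm_one_sub_smul_mul_of_pos (D := -D)
      (fun t => by simpa using hD (-t)) (neg_pos.2 hs) T
    simpa using this
  · simp
  · exact norm_le_norm_one_sub_smul_mul_of_pos hD hs T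

/-- Continuity method: go from 0 to `s` in `N` steps short enough that consecutive elements differ
by less than 1 in norm. Invertibility then propagates, and the lower bound applied to the new
inverse keeps it a contraction, so the step length need not shrink. -/
theorem HasContractiveInverse.one_sub_smul (h1 : ‖(1 : 𝔸)‖ ≤ 1) {D : 𝔸}
    (hD : ∀ t : ℝ, ‖NormedSpace.exp ((t : ℂ) • D)‖ ≤ 1) (s : ℝ) :
    HasContractiveInverse (1 - (s : ℂ) • D) := by
  obtain ⟨N, hN⟩ := exists_nat_gt (|s| * ‖D‖)
  have hN0 : (0 : ℝ) < N := lt_of_le_of_lt (by positivity) hN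
  have key : ∀ m : ℕ, HasContractiveInverse (1 - ((m * (s / N) : ℝ) : ℂ) • D) := by
    intro m
    induction m with
    | zero => simpa using HasContractiveInverse.one h1
    | succ m ih =>
      obtain ⟨U, hU⟩ := ih.isUnit_of_norm_sub_lt
        (B' := 1 - (((m + 1 : ℕ) * (s / N) : ℝ) : ℂ) • D) (by
          rw [sub_sub_sub_cancel_left, ← sub_smul, ← Complex.ofReal_sub, norm_smul,
            Complex.norm_real, Nat.cast_add, Nat.cast_one, add_mul, one_mul, add_sub_cancel_left,
            Real.norm_eq_abs, abs_div, Nat.abs_cast, div_mul_eq_mul_div, div_lt_one hN0]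
          exact hN)
      rw [← hU]
      refine ⟨_, U.mul_inv, U.inv_mul, ?_⟩
      refine (norm_le_norm_one_sub_smul_mul hD ((m + 1 : ℕ) * (s / N)) _).trans ?_
      rwa [← hU, U.mul_inv]
  simpa [mul_div_cancel₀ _ hN0.ne'] using key N

end Dissipative

/-! ### Evaluating the factorization at an operator -/

theorem IsWeierstrassFactorization.eq_zero_of_apply_zero_ne_zero {F : ℂ → ℂ} {lam alpha : ℂ}
    {n : ℕ} {ι : Type} {z : ι → ℝ} (h : IsWeierstrassFactorization F lam alpha n z)
    (h0 : F 0 ≠ 0) : n = 0 := by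
  obtain ⟨P, -, hF⟩ := h.factorization
  by_contra hn
  exact h0 (by rw [hF 0, zero_pow hn]; ring)

theorem IsWeierstrassFactorization.apply_zero {F : ℂ → ℂ} {lam alpha : ℂ}
    {ι : Type} {z : ι → ℝ} (h : IsWeierstrassFactorization F lam alpha 0 z) : F 0 = lam := by
  obtain ⟨P, hP, hF⟩ := h.factorization
  have : P 0 = 1 := (hP.hasProd (x := 0)).unique (by simp)
  rw [hF 0, this]; simp

section Operators

variable {E : Type*} [NormedAddCommGroup E] [NormedSpace ℂ E] [CompleteSpace E]

theorem hasContractiveInverse_entireCalculus_prod {A : E →L[ℂ] E} {ι : Type*}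
    {g : ι → ℂ → ℂ} (hg : ∀ k, Differentiable ℂ (g k))
    (hgA : ∀ k, HasContractiveInverse (entireCalculus (g k) A)) (s : Finset ι) :
    HasContractiveInverse (entireCalculus (fun w => ∏ k ∈ s, g k w) A) := by
  classical
  induction s using Finset.induction_on with
  | empty =>
    simp only [Finset.prod_empty, entireCalculus_one]
    exact .one ContinuousLinearMap.norm_id_le
  | insert k s hk ih =>
    simp only [Finset.prod_insert hk]
    rw [entireCalculus_mul (hg k) (by fun_prop)]
    exact (hgA k).mul ih

/-- Here `B` is the canonical product evaluated at `A`, the norm limit of its finite subproducts.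
All roots being imaginary is what puts each factor in the form `(1 - sD) exp(sD)` with `D = iA` and
`s` real. -/
theorem IsWeierstrassFactorization.exists_entireCalculus_eq {F : ℂ → ℂ} {lam alpha : ℂ} {n : ℕ}
    {ι : Type} {z : ι → ℝ} (h : IsWeierstrassFactorization F lam alpha n z) {A : E →L[ℂ] E}
    (hA : ∀ t : ℝ, ‖NormedSpace.exp ((Complex.I * t : ℂ) • A)‖ ≤ 1) :
    ∃ B C : E →L[ℂ] E, B * C = 1 ∧ C * B = 1 ∧ ‖C‖ ≤ 1 ∧
      entireCalculus F A = lam • (B * (NormedSpace.exp (alpha • A) * A ^ n)) := by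
  obtain ⟨P, hP, hF⟩ := h.factorization
  set g : ι → ℂ → ℂ := fun k w =>
    (1 - Complex.I * w / (z k : ℂ)) * Complex.exp (Complex.I * w / (z k : ℂ)) with hg
  have hgd : ∀ k, Differentiable ℂ (g k) := fun k => by fun_prop
  have hprodd : ∀ s : Finset ι, Differentiable ℂ (fun w => ∏ k ∈ s, g k w) := fun s => by fun_prop
  have hPd : Differentiable ℂ P := by
    rw [← differentiableOn_univ]
    exact (tendstoLocallyUniformlyOn_univ.2 hP).differentiableOn
      (Eventually.of_forall fun s => (hprodd s).differentiableOn) isOpen_univ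
  have hD : ∀ t : ℝ, ‖NormedSpace.exp ((t : ℂ) • (Complex.I • A))‖ ≤ 1 := fun t => by
    rw [smul_smul, mul_comm]; exact hA t
  have hgA : ∀ k, HasContractiveInverse (entireCalculus (g k) A) := by
    intro k
    have e : g k = fun w => (1 - (Complex.I * ((z k)⁻¹ : ℝ)) * w) *
        Complex.exp ((Complex.I * ((z k)⁻¹ : ℝ)) * w) := by
      funext w
      rw [hg]
      push_cast
      rw [show Complex.I * w / (z k : ℂ) = Complex.I * (z k : ℂ)⁻¹ * w by ring]
    rw [e, entireCalculus_mul (by fun_prop) (by fun_prop), entireCalculus_exp,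
      entireCalculus_one_sub_mul]
    refine .mul ?_ (.exp_smul _ ?_)
    · have := HasContractiveInverse.one_sub_smul (𝔸 := E →L[ℂ] E)
        ContinuousLinearMap.norm_id_le hD ((z k)⁻¹)
      rwa [smul_smul, mul_comm] at this
    · have := hA (-(z k)⁻¹)
      rwa [Complex.ofReal_neg, mul_neg] at this
  obtain ⟨C, hBC, hCB, hC⟩ := HasContractiveInverse.of_tendsto
    (hasContractiveInverse_entireCalculus_prod hgd hgA) (tendsto_entireCalculus hprodd hPd hP A)
  refine ⟨entireCalculus P A, C, hBC, hCB, hC, ?_⟩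
  have e : F = fun w => lam * (P w * (Complex.exp (alpha * w) * w ^ n)) := by
    funext w; rw [hF w]; ring
  rw [e, entireCalculus_const_mul (by fun_prop), entireCalculus_mul hPd (by fun_prop),
    entireCalculus_mul (by fun_prop) (by fun_prop), entireCalculus_exp, entireCalculus_pow]

theorem IsWeierstrassFactorization.norm_mul_le_norm_entireCalculus {F : ℂ → ℂ} {lam alpha : ℂ}
    {n : ℕ} {ι : Type} {z : ι → ℝ} (h : IsWeierstrassFactorization F lam alpha n z)
    {A : E →L[ℂ] E} (hA : ∀ t : ℝ, ‖NormedSpace.exp ((Complex.I * t : ℂ) • A)‖ ≤ 1) (T : E) :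
    ‖lam‖ * ‖(A ^ n * NormedSpace.exp ((alpha.re : ℂ) • A)) T‖ ≤ ‖entireCalculus F A T‖ := by
  -- Both operators are functions of `A`, so they commute because the scalar functions do.
  have hcomm : A ^ n * NormedSpace.exp ((alpha.re : ℂ) • A) =
      NormedSpace.exp ((alpha.re : ℂ) • A) * A ^ n := by
    rw [← entireCalculus_exp, ← entireCalculus_pow, ← entireCalculus_mul (by fun_prop)
      (by fun_prop), ← entireCalculus_mul (by fun_prop) (by fun_prop)]
    simp only [mul_comm]
  rw [hcomm]
  obtain ⟨B, C, -, hCB, hC, hF⟩ := h.exists_entireCalculus_eq hA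
  -- Undo the canonical product and the oscillating exponential; both inverses are contractions.
  have e : lam • (NormedSpace.exp ((alpha.re : ℂ) • A) * A ^ n) =
      NormedSpace.exp ((-(Complex.I * alpha.im) : ℂ) • A) * C * entireCalculus F A := by
    have h1 := exp_smul_mul_exp_neg_smul A (-(Complex.I * alpha.im) : ℂ)
    rw [neg_neg] at h1
    rw [hF, exp_smul_eq_exp_im_mul_exp_re alpha A, mul_smul_comm, mul_assoc _ C, ← mul_assoc C B,
      hCB, one_mul, mul_assoc _ _ (A ^ n), ← mul_assoc, h1, one_mul]
  have hW : ‖NormedSpace.exp ((-(Complex.I * alpha.im) : ℂ) • A) * C‖ ≤ 1 := by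
    refine (norm_mul_le _ _).trans (mul_le_one₀ ?_ (norm_nonneg _) hC)
    simpa using hA (-alpha.im)
  have e2 := congrArg (fun L : E →L[ℂ] E => ‖L T‖) e
  simp only [smul_apply, norm_smul] at e2
  refine e2.trans_le ?_
  have := ContinuousLinearMap.le_of_opNorm_le _ hW (entireCalculus F A T)
  rwa [one_mul] at this

theorem IsWeierstrassFactorization.exists_unit_entireCalculus {F : ℂ → ℂ} {lam alpha : ℂ}
    {ι : Type} {z : ι → ℝ} (h : IsWeierstrassFactorization F lam alpha 0 z)
    {A : E →L[ℂ] E} (hA : ∀ t : ℝ, ‖NormedSpace.exp ((Complex.I * t : ℂ) • A)‖ ≤ 1) :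
    ∃ U : (E →L[ℂ] E)ˣ, (U : E →L[ℂ] E) = entireCalculus F A ∧
      ‖((U⁻¹ : (E →L[ℂ] E)ˣ) : E →L[ℂ] E)‖
        ≤ ‖lam‖⁻¹ * ‖NormedSpace.exp ((-alpha.re : ℂ) • A)‖ := by
  obtain ⟨B, C, hBC, hCB, hC, hF⟩ := h.exists_entireCalculus_eq hA
  rw [pow_zero, mul_one] at hF
  have h1 := exp_smul_mul_exp_neg_smul A alpha
  have h2 := exp_smul_mul_exp_neg_smul A (-alpha)
  rw [neg_neg] at h2
  have hl := h.lam_ne_zero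
  refine ⟨⟨entireCalculus F A, lam⁻¹ • (NormedSpace.exp ((-alpha) • A) * C), ?_, ?_⟩, rfl, ?_⟩
  · rw [hF, smul_mul_smul_comm, mul_inv_cancel₀ hl, one_smul, mul_assoc, ← mul_assoc _ _ C, h1,
      one_mul, hBC]
  · rw [hF, smul_mul_smul_comm, inv_mul_cancel₀ hl, one_smul, mul_assoc, ← mul_assoc C, hCB,
      one_mul, h2]
  · change ‖lam⁻¹ • (NormedSpace.exp ((-alpha) • A) * C)‖ ≤ _
    rw [norm_smul, norm_inv]
    gcongr
    have h3 := hA (-alpha.im)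
    rw [exp_smul_eq_exp_im_mul_exp_re (-alpha) A, Complex.neg_im, Complex.neg_re]
    set W := NormedSpace.exp ((Complex.I * ((-alpha.im : ℝ) : ℂ)) • A)
    rw [Complex.ofReal_neg]
    calc _ ≤ ‖W‖ * ‖NormedSpace.exp ((-alpha.re : ℂ) • A)‖ * ‖C‖ :=
          (norm_mul_le _ _).trans (by gcongr; exact norm_mul_le _ _)
      _ ≤ 1 * ‖NormedSpace.exp ((-alpha.re : ℂ) • A)‖ * 1 := by gcongr
      _ = _ := by ring

end Operators

/-! ### Contractive bimodules over a C*-algebra -/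

section Bimodule

variable {M : Type*} [CStarAlgebra M]

theorem CStarAlgebra.norm_one_le : ‖(1 : M)‖ ≤ 1 := by
  rcases subsingleton_or_nontrivial M with h | h
  · simp [Subsingleton.elim (1 : M) 0]
  · simp

/-- The exponential is unitary. An inequality is stated because `M` may be trivial. -/
theorem norm_exp_I_mul_smul_le_one {X : M} (hX : IsSelfAdjoint X) (t : ℝ) :
    ‖NormedSpace.exp ((Complex.I * t : ℂ) • X)‖ ≤ 1 := by
  have htX : IsSelfAdjoint ((t : ℂ) • X) := IsSelfAdjoint.smul (Complex.conj_ofReal t) hX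
  have h := CStarRing.norm_coe_unitary_mul (selfAdjoint.expUnitary ⟨(t : ℂ) • X, htX⟩) 1
  rw [selfAdjoint.expUnitary_coe, mul_one] at h
  rw [mul_smul]
  exact h.trans_le CStarAlgebra.norm_one_le

variable {E : Type*} [NormedAddCommGroup E] [NormedSpace ℂ E]

/-- Commuting contractive representations of `M` and of its opposite algebra on a Banach space. -/
structure IsContractiveBimodule (l r : M →L[ℂ] E →L[ℂ] E) : Prop where
  left_one : l 1 = 1
  left_mul : ∀ X Y, l (X * Y) = l X * l Y
  norm_left_le : ∀ X, ‖l X‖ ≤ ‖X‖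
  right_one : r 1 = 1
  right_mul : ∀ X Y, r (X * Y) = r Y * r X
  norm_right_le : ∀ X, ‖r X‖ ≤ ‖X‖
  comm : ∀ X Y, l X * r Y = r Y * l X

namespace IsContractiveBimodule

variable {l r : M →L[ℂ] E →L[ℂ] E}

theorem left_pow (h : IsContractiveBimodule l r) (X : M) (k : ℕ) : l (X ^ k) = l X ^ k := by
  induction k with
  | zero => simp [h.left_one]
  | succ k ih => rw [pow_succ, h.left_mul, ih, pow_succ]

theorem right_pow (h : IsContractiveBimodule l r) (X : M) (k : ℕ) : r (X ^ k) = r X ^ k := by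
  induction k with
  | zero => simp [h.right_one]
  | succ k ih => rw [pow_succ', h.right_mul, ih, pow_succ]

variable [CompleteSpace E]

theorem map_exp_of_map_pow {φ : M →L[ℂ] E →L[ℂ] E} {X : M} (h : ∀ k, φ (X ^ k) = φ X ^ k) :
    φ (NormedSpace.exp X) = NormedSpace.exp (φ X) := by
  have h1 := φ.hasSum (NormedSpace.exp_series_hasSum_exp' (𝕂 := ℂ) X)
  have h2 := NormedSpace.exp_series_hasSum_exp' (𝕂 := ℂ) (φ X)
  refine h1.unique (h2.congr_fun fun k => ?_)
  rw [map_smul, h k]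

theorem exp_smul (h : IsContractiveBimodule l r) (c : ℂ) (X Y : M) :
    NormedSpace.exp (c • (l X + r Y)) =
      l (NormedSpace.exp (c • X)) * r (NormedSpace.exp (c • Y)) := by
  let := NormedAlgebra.restrictScalars ℚ ℂ (E →L[ℂ] E)
  rw [map_exp_of_map_pow (h.left_pow _), map_exp_of_map_pow (h.right_pow _), map_smul, map_smul,
    smul_add]
  have hc : Commute (l X) (r Y) := h.comm X Y
  exact NormedSpace.exp_add_of_commute ((hc.smul_left c).smul_right c)

theorem norm_exp_smul_le (h : IsContractiveBimodule l r) (c : ℂ) (X Y : M) :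
    ‖NormedSpace.exp (c • (l X + r Y))‖ ≤
      ‖NormedSpace.exp (c • X)‖ * ‖NormedSpace.exp (c • Y)‖ := by
  rw [h.exp_smul]
  exact (norm_mul_le _ _).trans
    (mul_le_mul (h.norm_left_le _) (h.norm_right_le _) (norm_nonneg _) (norm_nonneg _))

theorem norm_exp_I_mul_smul_le_one (h : IsContractiveBimodule l r) {X Y : M}
    (hX : IsSelfAdjoint X) (hY : IsSelfAdjoint Y) (t : ℝ) :
    ‖NormedSpace.exp ((Complex.I * t : ℂ) • (l X + r Y))‖ ≤ 1 :=
  (h.norm_exp_smul_le _ X Y).trans (mul_le_one₀ (_root_.norm_exp_I_mul_smul_le_one hX t)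
    (norm_nonneg _) (_root_.norm_exp_I_mul_smul_le_one hY t))

/-- Binomial theorem for the commuting pair `l X`, `r Y`. Since `r` reverses products, `r (exp(cY)
Y^(n-k))` applies the exponential first. -/
theorem pow_mul_exp_smul_apply (h : IsContractiveBimodule l r) (c : ℂ) (n : ℕ) (X Y : M) (T : E) :
    ((l X + r Y) ^ n * NormedSpace.exp (c • (l X + r Y))) T =
      ∑ k ∈ Finset.range (n + 1), (n.choose k : ℂ) •
        l (X ^ k * NormedSpace.exp (c • X)) (r (NormedSpace.exp (c • Y) * Y ^ (n - k)) T) := by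
  have hc : Commute (l X) (r Y) := h.comm X Y
  have e : (l X + r Y) ^ n * NormedSpace.exp (c • (l X + r Y)) =
      ∑ k ∈ Finset.range (n + 1), (n.choose k : ℂ) •
        (l (X ^ k * NormedSpace.exp (c • X)) *
          r (NormedSpace.exp (c • Y) * Y ^ (n - k))) := by
    rw [h.exp_smul, hc.add_pow, Finset.sum_mul]
    refine Finset.sum_congr rfl fun k _ => ?_
    have hswap := h.comm (NormedSpace.exp (c • X)) (Y ^ (n - k))
    rw [h.left_mul, h.right_mul, ← nsmul_eq_mul', smul_mul_assoc, Nat.cast_smul_eq_nsmul,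
      ← h.left_pow, ← h.right_pow, mul_assoc, ← mul_assoc (r _) (l _), ← hswap]
    simp only [mul_assoc]
  rw [e]
  simp

variable {F : ℂ → ℂ} {lam alpha : ℂ} {n : ℕ} {ι : Type} {z : ι → ℝ}

theorem norm_le_norm_entireCalculus (h : IsContractiveBimodule l r)
    (hF : IsWeierstrassFactorization F lam alpha n z) {X Y : M} (hX : IsSelfAdjoint X)
    (hY : IsSelfAdjoint Y) (T : E) :
    ‖lam‖ * ‖∑ k ∈ Finset.range (n + 1), (n.choose k : ℂ) •
        l (X ^ k * NormedSpace.exp ((alpha.re : ℂ) • X))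
          (r (NormedSpace.exp ((alpha.re : ℂ) • Y) * Y ^ (n - k)) T)‖
      ≤ ‖entireCalculus F (l X + r Y) T‖ := by
  rw [← h.pow_mul_exp_smul_apply]
  exact hF.norm_mul_le_norm_entireCalculus (h.norm_exp_I_mul_smul_le_one hX hY) T

theorem exists_unit_entireCalculus (h : IsContractiveBimodule l r)
    (hF : IsWeierstrassFactorization F lam alpha n z) (hF0 : F 0 ≠ 0) {X Y : M}
    (hX : IsSelfAdjoint X) (hY : IsSelfAdjoint Y) :
    ∃ U : (E →L[ℂ] E)ˣ, (U : E →L[ℂ] E) = entireCalculus F (l X + r Y) ∧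
      ‖((U⁻¹ : (E →L[ℂ] E)ˣ) : E →L[ℂ] E)‖
        ≤ ‖lam‖⁻¹ * ‖NormedSpace.exp (-((alpha.re : ℂ) • X))‖
            * ‖NormedSpace.exp (-((alpha.re : ℂ) • Y))‖ := by
  obtain rfl := hF.eq_zero_of_apply_zero_ne_zero hF0
  obtain ⟨U, hU, hUn⟩ := hF.exists_unit_entireCalculus (h.norm_exp_I_mul_smul_le_one hX hY)
  refine ⟨U, hU, hUn.trans ?_⟩
  rw [mul_assoc, ← neg_smul, ← neg_smul]
  gcongr
  exact h.norm_exp_smul_le _ X Y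

theorem norm_le_and_exists_unit_of_norm_eq_one (h : IsContractiveBimodule l r)
    (hF : IsWeierstrassFactorization F lam alpha n z) (hF0 : ‖F 0‖ = 1) (hα : alpha.re = 0)
    {X Y : M} (hX : IsSelfAdjoint X) (hY : IsSelfAdjoint Y) :
    (∀ T : E, ‖T‖ ≤ ‖entireCalculus F (l X + r Y) T‖) ∧
      ∃ U : (E →L[ℂ] E)ˣ, (U : E →L[ℂ] E) = entireCalculus F (l X + r Y) ∧
        ‖((U⁻¹ : (E →L[ℂ] E)ˣ) : E →L[ℂ] E)‖ ≤ 1 := by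
  have hF0' : F 0 ≠ 0 := fun h0 => by simp [h0] at hF0
  obtain rfl := hF.eq_zero_of_apply_zero_ne_zero hF0'
  rw [hF.apply_zero] at hF0
  obtain ⟨U, hU, hUn⟩ := h.exists_unit_entireCalculus hF hF0' hX hY
  have hU1 : ‖((U⁻¹ : (E →L[ℂ] E)ˣ) : E →L[ℂ] E)‖ ≤ 1 := by
    refine hUn.trans ?_
    let := NormedAlgebra.restrictScalars ℚ ℂ M
    rw [hF0, hα]
    simp only [inv_one, Complex.ofReal_zero, zero_smul, neg_zero, NormedSpace.exp_zero, one_mul]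
    exact mul_le_one₀ CStarAlgebra.norm_one_le (norm_nonneg _) CStarAlgebra.norm_one_le
  refine ⟨fun T => ?_, U, hU, hU1⟩
  have := ContinuousLinearMap.le_of_opNorm_le _ hU1 (entireCalculus F (l X + r Y) T)
  rw [← hU, one_mul] at this
  have e : (↑U⁻¹ : E →L[ℂ] E) ((U : E →L[ℂ] E) T) = T :=
    congrArg (fun L : E →L[ℂ] E => L T) U.inv_mul
  rwa [e, hU] at this

end IsContractiveBimodule

end Bimodule

/-! ### Comparison of the real and complex calculi -/

section RealScalars

/-- On the real line the imaginary parts of the coefficients form a real power series for the zero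
function, so they vanish by uniqueness. -/
theorem im_taylorCoeff_eq_zero {F : ℂ → ℂ} (hF : Differentiable ℂ F)
    (hre : ∀ x : ℝ, (F x).im = 0) (k : ℕ) : (taylorCoeff F k).im = 0 := by
  have hp : HasFPowerSeriesAt (fun _ : ℝ => (0 : ℝ))
      (FormalMultilinearSeries.ofScalars ℝ fun k => (taylorCoeff F k).im) 0 := by
    rw [hasFPowerSeriesAt_iff]
    refine Eventually.of_forall fun x => ?_
    have h := Complex.hasSum_im (hasSum_taylorCoeff hF x)
    rw [hre] at h
    refine h.congr_fun fun k => ?_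
    rw [FormalMultilinearSeries.coeff_ofScalars, ← Complex.ofReal_pow, Complex.im_mul_ofReal,
      smul_eq_mul, mul_comm]
  have h0 := congrArg (fun p => FormalMultilinearSeries.coeff p k)
    (HasFPowerSeriesAt.eq_zero (𝕜 := ℝ) (E := ℝ) (x := 0) hp)
  rw [FormalMultilinearSeries.coeff_ofScalars] at h0
  exact h0

variable {E : Type*} [NormedAddCommGroup E] [NormedSpace ℝ E] [NormedSpace ℂ E]
  [IsScalarTower ℝ ℂ E]

theorem realEntireCalculus_apply_eq [CompleteSpace E] {F : ℂ → ℂ} (hF : Differentiable ℂ F)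
    (hre : ∀ x : ℝ, (F x).im = 0) {A : E →L[ℂ] E} {B : E →L[ℝ] E} (hAB : ∀ T, B T = A T) (T : E) :
    realEntireCalculus F B T = entireCalculus F A T := by
  have h1 := (realEntireCalculus_hasSum hF B).mapL (ContinuousLinearMap.apply ℝ E T)
  have h2 := (entireCalculus_hasSum hF A).mapL (ContinuousLinearMap.apply ℂ E T)
  refine h1.unique (h2.congr_fun fun k => ?_)
  have hpow : (B ^ k) T = (A ^ k) T := by
    induction k with
    | zero => simp
    | succ k ih => rw [pow_succ', pow_succ', mul_apply_eq_comp, mul_apply_eq_comp, ih, hAB]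
  have hc : taylorCoeff F k = ((taylorCoeff F k).re : ℂ) :=
    Complex.ext (by simp) (by simpa using im_taylorCoeff_eq_zero hF hre k)
  simp only [ContinuousLinearMap.apply_apply, smul_apply]
  conv_rhs => rw [hc]
  rw [hpow]
  exact (algebraMap_smul ℂ _ _).symm

theorem exists_unit_restrictScalars {B : E →L[ℝ] E} {A : E →L[ℂ] E} (hAB : ∀ T, B T = A T) {c : ℝ}
    (h : ∃ U : (E →L[ℂ] E)ˣ, (U : E →L[ℂ] E) = A ∧
      ‖((U⁻¹ : (E →L[ℂ] E)ˣ) : E →L[ℂ] E)‖ ≤ c) :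
    ∃ U : (E →L[ℝ] E)ˣ, (U : E →L[ℝ] E) = B ∧
      ‖((U⁻¹ : (E →L[ℝ] E)ˣ) : E →L[ℝ] E)‖ ≤ c := by
  obtain ⟨U, rfl, hU⟩ := h
  refine ⟨⟨B, (U⁻¹ : (E →L[ℂ] E)ˣ).1.restrictScalars ℝ, ?_, ?_⟩, rfl, ?_⟩
  · ext T
    exact (hAB _).trans (congrArg (fun L : E →L[ℂ] E => L T) U.mul_inv)
  · ext T
    refine (congrArg (↑U⁻¹ : E →L[ℂ] E) (hAB T)).trans ?_
    exact congrArg (fun L : E →L[ℂ] E => L T) U.inv_mul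
  · exact (ContinuousLinearMap.norm_restrictScalars _).trans_le hU

end RealScalars

/-! ### Normed ideals as contractive bimodules -/

noncomputable section

namespace NormedIdeal

variable {𝕜 M : Type*} [RCLike 𝕜] [CStarAlgebra M] [Algebra 𝕜 M] (I : NormedIdeal 𝕜 M)

theorem ext_of_coe {A B : I.Space →L[𝕜] I.Space}
    (h : ∀ T : I.Core, A (T : I.Space) = B (T : I.Space)) : A = B :=
  ContinuousLinearMap.ext fun T => congrFun
    (UniformSpace.Completion.denseRange_coe.equalizer A.continuous B.continuous (funext h)) T

theorem L_one : I.L 1 = 1 := I.ext_of_coe fun T => by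
  rw [L_coe]
  exact congrArg _ (Subtype.ext (one_mul T.1))

theorem R_one : I.R 1 = 1 := I.ext_of_coe fun T => by
  rw [R_coe]
  exact congrArg _ (Subtype.ext (mul_one T.1))

theorem L_mul (X Y : M) : I.L (X * Y) = I.L X * I.L Y := I.ext_of_coe fun T => by
  rw [mul_apply_eq_comp, L_coe, L_coe, L_coe]
  exact congrArg _ (Subtype.ext (mul_assoc X Y T.1))

theorem R_mul (X Y : M) : I.R (X * Y) = I.R Y * I.R X := I.ext_of_coe fun T => by
  rw [mul_apply_eq_comp, R_coe, R_coe, R_coe]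
  exact congrArg _ (Subtype.ext (mul_assoc T.1 X Y).symm)

theorem L_mul_R (X Y : M) : I.L X * I.R Y = I.R Y * I.L X := I.ext_of_coe fun T => by
  rw [mul_apply_eq_comp, mul_apply_eq_comp, R_coe, L_coe, L_coe, R_coe]
  exact congrArg _ (Subtype.ext (mul_assoc X T.1 Y).symm)

theorem L_add (X Y : M) : I.L (X + Y) = I.L X + I.L Y := I.ext_of_coe fun T => by
  rw [add_apply, L_coe, L_coe, L_coe, ← UniformSpace.Completion.coe_add]
  exact congrArg _ (Subtype.ext (add_mul X Y T.1))

theorem R_add (X Y : M) : I.R (X + Y) = I.R X + I.R Y := I.ext_of_coe fun T => by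
  rw [add_apply, R_coe, R_coe, R_coe, ← UniformSpace.Completion.coe_add]
  exact congrArg _ (Subtype.ext (mul_add T.1 X Y))

theorem L_smul (c : 𝕜) (X : M) : I.L (c • X) = c • I.L X := I.ext_of_coe fun T => by
  rw [smul_apply, L_coe, L_coe, ← UniformSpace.Completion.coe_smul]
  exact congrArg _ (Subtype.ext (smul_mul_assoc c X T.1))

theorem R_smul (c : 𝕜) (X : M) : I.R (c • X) = c • I.R X := I.ext_of_coe fun T => by
  rw [smul_apply, R_coe, R_coe, ← UniformSpace.Completion.coe_smul]
  exact congrArg _ (Subtype.ext (mul_smul_comm c T.1 X))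

theorem norm_apply_le_of_coe {A : I.Space →L[𝕜] I.Space} {c : ℝ}
    (h : ∀ T : I.Core, ‖A (T : I.Space)‖ ≤ c * ‖T‖) (T : I.Space) : ‖A T‖ ≤ c * ‖T‖ := by
  induction T using UniformSpace.Completion.induction_on with
  | hp => exact isClosed_le A.continuous.norm (continuous_const.mul continuous_norm)
  | ih T => simpa using h T

theorem norm_L_apply_le (X : M) (T : I.Space) : ‖I.L X T‖ ≤ ‖X‖ * ‖T‖ := by
  refine I.norm_apply_le_of_coe (fun T => ?_) T
  rw [L_coe, UniformSpace.Completion.norm_coe]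
  refine ((I.coreL X).le_of_opNorm_le
    (LinearMap.mkContinuous_norm_le _ (by positivity) _) T).trans ?_
  gcongr
  exact mul_le_of_le_one_right (norm_nonneg _) CStarAlgebra.norm_one_le

theorem norm_R_apply_le (X : M) (T : I.Space) : ‖I.R X T‖ ≤ ‖X‖ * ‖T‖ := by
  refine I.norm_apply_le_of_coe (fun T => ?_) T
  rw [R_coe, UniformSpace.Completion.norm_coe]
  refine ((I.coreR X).le_of_opNorm_le
    (LinearMap.mkContinuous_norm_le _ (by positivity) _) T).trans ?_
  gcongr
  exact mul_le_of_le_one_left (norm_nonneg _) CStarAlgebra.norm_one_le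

end NormedIdeal

section Complex

variable {M : Type*} [CStarAlgebra M]

/-- Left multiplication as a contractive linear map into the bounded operators. -/
def NormedIdeal.leftMul (I : NormedIdeal ℂ M) : M →L[ℂ] I.Space →L[ℂ] I.Space :=
  LinearMap.mkContinuous ⟨⟨I.L, I.L_add⟩, I.L_smul⟩ 1 fun X => by
    rw [one_mul]
    exact ContinuousLinearMap.opNorm_le_bound _ (norm_nonneg _) (I.norm_L_apply_le X)

/-- Right multiplication as a contractive linear map into the bounded operators. -/
def NormedIdeal.rightMul (I : NormedIdeal ℂ M) : M →L[ℂ] I.Space →L[ℂ] I.Space :=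
  LinearMap.mkContinuous ⟨⟨I.R, I.R_add⟩, I.R_smul⟩ 1 fun X => by
    rw [one_mul]
    exact ContinuousLinearMap.opNorm_le_bound _ (norm_nonneg _) (I.norm_R_apply_le X)

theorem NormedIdeal.isContractiveBimodule (I : NormedIdeal ℂ M) :
    IsContractiveBimodule I.leftMul I.rightMul where
  left_one := I.L_one
  left_mul := I.L_mul
  norm_left_le X := ContinuousLinearMap.opNorm_le_bound _ (norm_nonneg _) (I.norm_L_apply_le X)
  right_one := I.R_one
  right_mul := I.R_mul
  norm_right_le X := ContinuousLinearMap.opNorm_le_bound _ (norm_nonneg _) (I.norm_R_apply_le X)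
  comm := I.L_mul_R

end Complex

/-! ### Complex structure on a real normed ideal -/

namespace NormedIdeal

variable {M : Type*} [CStarAlgebra M] (I : NormedIdeal ℝ M)

/-- The complex structure `c • T = L_{c1} T` on a real normed ideal. -/
abbrev complexSpace : NormedSpace ℂ I.Space where
  smul c T := I.L (c • 1) T
  one_smul T := by
    change I.L ((1 : ℂ) • 1) T = T
    rw [one_smul, L_one]; rfl
  mul_smul c d T := by
    change I.L ((c * d) • 1) T = I.L (c • 1) (I.L (d • 1) T)
    rw [← mul_apply_eq_comp, ← L_mul, smul_mul_smul_comm, one_mul]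
  smul_zero c := map_zero (I.L (c • 1))
  smul_add c := map_add (I.L (c • 1))
  add_smul c d T := by
    change I.L ((c + d) • 1) T = I.L (c • 1) T + I.L (d • 1) T
    rw [add_smul, L_add]; rfl
  zero_smul T := by
    change I.L ((0 : ℂ) • 1) T = 0
    have h := I.L_smul 0 (1 : M)
    rw [zero_smul] at h
    rw [zero_smul, h, zero_smul]; rfl
  norm_smul_le c T := by
    refine (I.norm_L_apply_le _ T).trans ?_
    gcongr
    rw [norm_smul]
    exact mul_le_of_le_one_right (norm_nonneg _) CStarAlgebra.norm_one_le

theorem isScalarTower_complexSpace :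
    letI := I.complexSpace
    IsScalarTower ℝ ℂ I.Space :=
  letI := I.complexSpace
  ⟨fun x c T => by
    change I.L ((x • c) • 1) T = x • I.L (c • 1) T
    rw [smul_assoc, L_smul]; rfl⟩

theorem R_smul_one (c : ℂ) : I.R (c • 1) = I.L (c • 1) := I.ext_of_coe fun T => by
  rw [L_coe, R_coe]
  exact congrArg _ (Subtype.ext ((mul_smul_one c T.1).trans (smul_one_mul c T.1).symm))

/-- Since `c1` is central, `L_X` and `R_Y` commute with the new scalars. Complex linearity of `Y ↦
R_Y` needs moreover that `c1` acts in the same way from both sides, `R_smul_one`. -/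
theorem exists_isContractiveBimodule_complexSpace :
    letI := I.complexSpace
    ∃ l r : M →L[ℂ] I.Space →L[ℂ] I.Space, IsContractiveBimodule l r ∧
      (∀ X T, l X T = I.L X T) ∧ ∀ X T, r X T = I.R X T := by
  let := I.complexSpace
  let lX : M → I.Space →L[ℂ] I.Space := fun X =>
    ⟨⟨⟨I.L X, map_add (I.L X)⟩, fun c T => by
      change I.L X (I.L (c • 1) T) = I.L (c • 1) (I.L X T)
      rw [← mul_apply_eq_comp, ← mul_apply_eq_comp, ← L_mul, ← L_mul, mul_smul_one, smul_one_mul]⟩,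
      (I.L X).continuous⟩
  let rX : M → I.Space →L[ℂ] I.Space := fun X =>
    ⟨⟨⟨I.R X, map_add (I.R X)⟩, fun c T => by
      change I.R X (I.L (c • 1) T) = I.L (c • 1) (I.R X T)
      rw [← mul_apply_eq_comp, ← mul_apply_eq_comp, L_mul_R]⟩,
      (I.R X).continuous⟩
  have hl : ∀ X, ‖lX X‖ ≤ ‖X‖ := fun X =>
    ContinuousLinearMap.opNorm_le_bound _ (norm_nonneg _) (I.norm_L_apply_le X)
  have hr : ∀ X, ‖rX X‖ ≤ ‖X‖ := fun X =>
    ContinuousLinearMap.opNorm_le_bound _ (norm_nonneg _) (I.norm_R_apply_le X)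
  have happ : ∀ {A B : I.Space →L[ℝ] I.Space}, A = B → ∀ T, A T = B T := fun h T => by rw [h]
  let l : M →L[ℂ] I.Space →L[ℂ] I.Space := LinearMap.mkContinuous
    ⟨⟨lX, fun X Y => ContinuousLinearMap.ext (happ (I.L_add X Y))⟩, fun c X =>
      ContinuousLinearMap.ext fun T => by
        change I.L (c • X) T = I.L (c • 1) (I.L X T)
        rw [← mul_apply_eq_comp, ← L_mul, smul_one_mul]⟩ 1 (by simpa using hl)
  let r : M →L[ℂ] I.Space →L[ℂ] I.Space := LinearMap.mkContinuous
    ⟨⟨rX, fun X Y => ContinuousLinearMap.ext (happ (I.R_add X Y))⟩, fun c X =>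
      ContinuousLinearMap.ext fun T => by
        change I.R (c • X) T = I.L (c • 1) (I.R X T)
        rw [← I.R_smul_one, ← mul_apply_eq_comp, ← R_mul, mul_smul_one]⟩ 1 (by simpa using hr)
  refine ⟨l, r, ?_, fun _ _ => rfl, fun _ _ => rfl⟩
  exact
    { left_one := ContinuousLinearMap.ext (happ I.L_one)
      left_mul := fun X Y => ContinuousLinearMap.ext (happ (I.L_mul X Y))
      norm_left_le := hl
      right_one := ContinuousLinearMap.ext (happ I.R_one)
      right_mul := fun X Y => ContinuousLinearMap.ext (happ (I.R_mul X Y))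
      norm_right_le := hr
      comm := fun X Y => ContinuousLinearMap.ext (happ (I.L_mul_R X Y)) }

end NormedIdeal

end

/-! ### The main theorem -/

theorem theorem2 {M : Type*} [CStarAlgebra M] (F : ℂ → ℂ) (hF : Differentiable ℂ F)
    (hord : growthOrder F ≤ 1) (hroots : ∀ w : ℂ, w ≠ 0 → F w = 0 → w.re = 0) :
    (∃ (lam alpha : ℂ) (n : ℕ) (ι : Type) (z : ι → ℝ),
      IsWeierstrassFactorization F lam alpha n z) ∧
    ∀ (lam alpha : ℂ) (n : ℕ) (ι : Type) (z : ι → ℝ),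
      IsWeierstrassFactorization F lam alpha n z →
      -- complex ideals
      (∀ (I : NormedIdeal ℂ M) (X Y : M), IsSelfAdjoint X → IsSelfAdjoint Y →
        (∀ T : I.Space,
          ‖lam‖ * ‖∑ k ∈ Finset.range (n + 1), (n.choose k : ℂ) •
              I.L (X ^ k * NormedSpace.exp ((alpha.re : ℂ) • X))
                (I.R (NormedSpace.exp ((alpha.re : ℂ) • Y) * Y ^ (n - k)) T)‖
            ≤ ‖entireCalculus F (I.L X + I.R Y) T‖) ∧
        (F 0 ≠ 0 → ∃ U : (I.Space →L[ℂ] I.Space)ˣ,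
          (U : I.Space →L[ℂ] I.Space) = entireCalculus F (I.L X + I.R Y) ∧
          ‖((U⁻¹ : (I.Space →L[ℂ] I.Space)ˣ) : I.Space →L[ℂ] I.Space)‖
            ≤ ‖lam‖⁻¹ * ‖NormedSpace.exp (-((alpha.re : ℂ) • X))‖
                * ‖NormedSpace.exp (-((alpha.re : ℂ) • Y))‖) ∧
        (‖F 0‖ = 1 → alpha.re = 0 →
          (∀ T : I.Space, ‖T‖ ≤ ‖entireCalculus F (I.L X + I.R Y) T‖) ∧
          ∃ U : (I.Space →L[ℂ] I.Space)ˣ,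
            (U : I.Space →L[ℂ] I.Space) = entireCalculus F (I.L X + I.R Y) ∧
            ‖((U⁻¹ : (I.Space →L[ℂ] I.Space)ˣ) : I.Space →L[ℂ] I.Space)‖ ≤ 1)) ∧
      -- real ideals
      ((∀ x : ℝ, (F x).im = 0) →
        ∀ (I : NormedIdeal ℝ M) (X Y : M), IsSelfAdjoint X → IsSelfAdjoint Y →
        (∀ T : I.Space,
          ‖lam‖ * ‖∑ k ∈ Finset.range (n + 1), (n.choose k : ℝ) •
              I.L (X ^ k * NormedSpace.exp (alpha.re • X))
                (I.R (NormedSpace.exp (alpha.re • Y) * Y ^ (n - k)) T)‖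
            ≤ ‖realEntireCalculus F (I.L X + I.R Y) T‖) ∧
        (F 0 ≠ 0 → ∃ U : (I.Space →L[ℝ] I.Space)ˣ,
          (U : I.Space →L[ℝ] I.Space) = realEntireCalculus F (I.L X + I.R Y) ∧
          ‖((U⁻¹ : (I.Space →L[ℝ] I.Space)ˣ) : I.Space →L[ℝ] I.Space)‖
            ≤ ‖lam‖⁻¹ * ‖NormedSpace.exp (-(alpha.re • X))‖
                * ‖NormedSpace.exp (-(alpha.re • Y))‖) ∧
        (‖F 0‖ = 1 → alpha.re = 0 →
          (∀ T : I.Space, ‖T‖ ≤ ‖realEntireCalculus F (I.L X + I.R Y) T‖) ∧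
          ∃ U : (I.Space →L[ℝ] I.Space)ˣ,
            (U : I.Space →L[ℝ] I.Space) = realEntireCalculus F (I.L X + I.R Y) ∧
            ‖((U⁻¹ : (I.Space →L[ℝ] I.Space)ˣ) : I.Space →L[ℝ] I.Space)‖ ≤ 1)) := by
  refine ⟨exists_isWeierstrassFactorization hF hord hroots, fun lam alpha n ι z h => ⟨?_, ?_⟩⟩
  · intro I X Y hX hY
    have hI := I.isContractiveBimodule
    exact ⟨hI.norm_le_norm_entireCalculus h hX hY,
      fun h0 => hI.exists_unit_entireCalculus h h0 hX hY,
      fun h0 hα => hI.norm_le_and_exists_unit_of_norm_eq_one h h0 hα hX hY⟩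
  · intro hre I X Y hX hY
    -- The norm on the completion is unchanged, so the complex estimates transfer verbatim once the
    -- two calculi are identified pointwise.
    let := I.complexSpace
    have := I.isScalarTower_complexSpace
    obtain ⟨l, r, hlr, hl, hr⟩ := I.exists_isContractiveBimodule_complexSpace
    have hAB : ∀ T, (I.L X + I.R Y) T = (l X + r Y) T := fun T => by
      rw [add_apply, add_apply, hl, hr]
    have hcalc := realEntireCalculus_apply_eq hF hre hAB
    refine ⟨fun T => ?_, fun h0 => ?_, fun h0 hα => ?_⟩
    · rw [hcalc]
      simpa only [Complex.coe_smul, Nat.cast_smul_eq_nsmul, hl, hr] using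
        hlr.norm_le_norm_entireCalculus h hX hY T
    · have hU := hlr.exists_unit_entireCalculus h h0 hX hY
      simp only [Complex.coe_smul] at hU
      exact exists_unit_restrictScalars hcalc hU
    · obtain ⟨hT, hU⟩ := hlr.norm_le_and_exists_unit_of_norm_eq_one h h0 hα hX hY
      exact ⟨fun T => (hT T).trans_eq (congrArg _ (hcalc T).symm),
        exists_unit_restrictScalars hcalc hU⟩
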